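/- Let $\mathbb F_q$ be a finite field with $q>2$ elements. For $d\ge 0$ let $C_{2,d}\subseteq \mathbb F_q^{\,q^2+q+1}$ be the projective Reed--Muller code, i.e. the image of the space $\mathbb F_q[x,y,z]_d$ of forms of degree $d$ (with $0$) under evaluation at fixed affine representatives of the $q^2+q+1$ points of $\mathbb P^2(\mathbb F_q)$. For a code $C$ of length $n$ let $W_C(X,Y)=\sum_{c\in C}X^{n-\mathrm{wt}(c)}Y^{\mathrm{wt}(c)}$, and for two codes let $W^{[2]}_{C_1,C_2}(X,Y)=\sum_{c_1\in C_1,\,c_2\in C_2}X^{n-\mathrm{wt}(c_1,c_2)}Y^{\mathrm{wt}(c_1,c_2)}$, where $\mathrm{wt}(c)$ is the number of nonzero coordinates of $c$ and $\mathrm{wt}(c_1,c_2)$ is the number of coordinates in which $c_1,c_2$ are not both $0$. Say that two forms share a common component if they have a common irreducible factor over $\overline{\mathbb F_q}$, and let $W^{[2],\mathrm{com}}_{C_{2,2},C_{2,3}}(X,Y)$ be the contribution to $W^{[2]}_{C_{2,2},C_{2,3}}(X,Y)$ of the pairs $(f,g)$ of a nonzero $f\in\mathbb F_q[x,y,z]_2$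 and a nonzero $g\in\mathbb F_q[x,y,z]_3$ that share a common component. For $0\le k\le 6$ let $c_k$ be the number of pairs $(f,g)$ of a nonzero $f\in\mathbb F_q[x,y,z]_2$ and a nonzero $g\in\mathbb F_q[x,y,z]_3$ that do not share a common component and have exactly $k$ common zeros in $\mathbb P^2(\mathbb F_q)$. Then \begin{align*} W^{[2]}_{C_{2,2},C_{2,3}}(X,Y) ={}& W_{C_{2,2}}(X,Y)+W_{C_{2,3}}(X,Y)-X^{q^2+q+1}\\ &+W^{[2],\mathrm{com}}_{C_{2,2},C_{2,3}}(X,Y)+\sum_{k=0}^{6}c_kX^kY^{q^2+q+1-k}, \end{align*} and \begin{align*} c_0 ={}& \tfrac{53}{144}(q-1)^3q^6(q^2+q+1)\\ &\cdot\left(q^5+q^4+\tfrac{9}{53}q^3+\tfrac{27}{53}q^2+\tfrac{58}{53}q-\tfrac{32}{53}\right),\\ c_1 ={}& \tfrac{11}{30}q^4(q-1)^2(q^2+q+1)(q+1)\\ &\cdot\left(q^7+\tfrac1{44}q^6+\tfrac5{11}q^5+\tfrac{20}{11}q^4-\tfrac{31}{11}q^3+\tfrac{159}{44}q^2+\tfrac{15}{11}q-\tfrac{30}{11}\right),\\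 c_2 ={}& \tfrac{3}{16}(q-1)^2(q+1)^2q^5(q^2+q+1)\\ &\cdot\left(q^5-\tfrac29q^4+\tfrac{35}9q^3-\tfrac{70}9q^2+\tfrac{160}9q-\tfrac{32}3\right),\\ c_3 ={}& \tfrac1{18}(q+1)(q-1)^3q^5(q^2+q+1)\\ &\cdot\left(q^5+\tfrac92q^4+\tfrac32q^3+\tfrac{39}2q^2+\tfrac{79}2q-9\right),\\ c_4 ={}& \tfrac1{48}(q+1)(q-1)^3q^6(q^2+q+1)\left(q^4+13q^2+26q-48\right),\\ c_5 ={}& \tfrac1{24}(q+1)(q-1)^4q^6(q^2+q+1)(q^2+2q-5),\\ c_6 ={}& \tfrac1{720}(q-2)(q+1)(q-1)^4q^6(q^2+q+1)(q^2+3q-8). \end{align*} -/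

import Mathlib

open scoped LinearAlgebra.Projectivization

namespace ConicCubic

noncomputable section

/-! ## Codes and weight enumerators

A code of length `#ι` over `F` is a linear subspace of `ι → F`; its coordinates are indexed by
the finite type `ι`. Weight enumerators are polynomials in `X = X 0` and `Y = X 1`. -/

/-- The Hamming weight of a word. -/
def wt {F ι : Type*} [Zero F] (c : ι → F) : ℕ :=
  {i | c i ≠ 0}.ncard

/-- The weight of a pair of words: the number of coordinates in which they are not both zero. -/
def wtPair {F ι : Type*} [Zero F] (c₁ c₂ : ι → F) : ℕ :=
  {i | ¬ (c₁ i = 0 ∧ c₂ i = 0)}.ncard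

/-- The monomial `X ^ (n - w) * Y ^ w` recorded by a word (or pair of words) of length `n` and
weight `w`. -/
def wtMonomial (n w : ℕ) : MvPolynomial (Fin 2) ℤ :=
  MvPolynomial.X 0 ^ (n - w) * MvPolynomial.X 1 ^ w

/-- The Hamming weight enumerator of a code `C`. The sum is finite when `F` and `ι` are. -/
def weightEnum {F ι : Type*} [Field F] (C : Submodule F (ι → F)) : MvPolynomial (Fin 2) ℤ :=
  ∑ᶠ c : C, wtMonomial (Nat.card ι) (wt (c : ι → F))

/-- The second weight enumerator of a pair of codes `C₁`, `C₂`. -/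
def weightEnum₂ {F ι : Type*} [Field F] (C₁ C₂ : Submodule F (ι → F)) :
    MvPolynomial (Fin 2) ℤ :=
  ∑ᶠ c : C₁ × C₂, wtMonomial (Nat.card ι) (wtPair (c.1 : ι → F) (c.2 : ι → F))

/-! ## Projective Reed-Muller codes -/

/-- The evaluation map on polynomials in `x_0, …, x_n`: evaluate at a chosen affine representative
of every point of `ℙ^n(F)`. -/
def ev (F : Type*) [Field F] (n : ℕ) :
    MvPolynomial (Fin (n + 1)) F →ₗ[F] (ℙ F (Fin (n + 1) → F) → F) :=
  LinearMap.pi fun p => (MvPolynomial.aeval p.rep).toLinearMap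

/-- The projective Reed-Muller code `C_{n,d}`: the image under evaluation of the space of forms of
degree `d` in `n + 1` variables (including the zero form). -/
def projRM (F : Type*) [Field F] (n d : ℕ) : Submodule F (ℙ F (Fin (n + 1) → F) → F) :=
  (MvPolynomial.homogeneousSubmodule (Fin (n + 1)) F d).map (ev F n)

/-! ## Pairs of a conic and a cubic -/

/-- `f` and `g` share a common component, that is, they have a common irreducible factor over the
algebraic closure of `F`. -/
def ShareComponent {F : Type*} [Field F] {n : ℕ} (f g : MvPolynomial (Fin (n + 1)) F) : Prop :=
  ∃ h : MvPolynomial (Fin (n + 1)) (AlgebraicClosure F), Irreducible h ∧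
    h ∣ MvPolynomial.map (algebraMap F (AlgebraicClosure F)) f ∧
    h ∣ MvPolynomial.map (algebraMap F (AlgebraicClosure F)) g

/-- The common zeros of `f` and `g` in `ℙ^n(F)` (used for homogeneous `f` and `g`, for which the
choice of representatives is immaterial). -/
def commonZeros {F : Type*} [Field F] {n : ℕ} (f g : MvPolynomial (Fin (n + 1)) F) :
    Set (ℙ F (Fin (n + 1) → F)) :=
  {p | MvPolynomial.eval p.rep f = 0 ∧ MvPolynomial.eval p.rep g = 0}

/-- The pairs of a nonzero quadratic form and a nonzero cubic form in three variables. -/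
def conicCubicPairs (F : Type*) [Field F] :
    Set (MvPolynomial (Fin 3) F × MvPolynomial (Fin 3) F) :=
  {x | x.1.IsHomogeneous 2 ∧ x.1 ≠ 0 ∧ x.2.IsHomogeneous 3 ∧ x.2 ≠ 0}

/-- `c_k`: the number of pairs of a nonzero quadratic form and a nonzero cubic form over `F` that
share no common component and have exactly `k` common zeros in `ℙ^2(F)`. -/
def numPairs (F : Type*) [Field F] (k : ℕ) : ℕ :=
  {x ∈ conicCubicPairs F | ¬ ShareComponent (n := 2) x.1 x.2 ∧
    (commonZeros (n := 2) x.1 x.2).ncard = k}.ncard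

/-- The contribution to the second weight enumerator of `C_{2,2}`, `C_{2,3}` from pairs of a nonzero
quadratic form and a nonzero cubic form that share a common component. -/
def weightEnumCom (F : Type*) [Field F] : MvPolynomial (Fin 2) ℤ :=
  ∑ᶠ x ∈ {x ∈ conicCubicPairs F | ShareComponent (n := 2) x.1 x.2},
    wtMonomial (Nat.card (ℙ F (Fin 3 → F))) (wtPair (ev F 2 x.1) (ev F 2 x.2))

end

end ConicCubic

/-! Fix a nonzero conic `f` and let `g` run over the cubics without a common component with `f`.
Summing the binomials C(|Z(f) ∩ Z(g)|, j) gives `moment f j`, which counts pairs of a `j`-subset `S`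
of Z(f) and such a `g` vanishing on `S`. When the points of `S` impose independent conditions on
cubics (`Separated`), exactly q^(10-j) cubics pass through `S`; those sharing a component with `f`
are multiples of `f` or of a linear factor of `f`, and can be counted and removed. So the moment
depends only on the type of `f`: conjugate lines, smooth conic, double line, or two rational lines
(`moment_irreducible`, `moment_double`, `moment_two_lines`).

The number of conics of each type comes from the same double count applied to conics in the plane,
together with a direct count of double lines (`sum_choose_conicPoints`, `typeCount_two`). Weighted
by these numbers, the moments become the binomial moments of the sequence c_k. As there are at most
six common zeros (`ncard_zeros_inter_le_six`), the moments for j = 0, …, 6 determine all c_k by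
binomial inversion (`numPairs_values`).

Independence is shown by separating points with products of lines (`exists_form_of_cover`). It also
replaces Bézout: a form vanishing at sufficiently many independent points of `f` is a multiple of
`f`, by comparing cardinalities (`formsThrough_eq_map`). The algebraic closure matters only through
`shareComponent_iff_dvd`: for `f` irreducible over the base field, a common geometric component
already means `f ∣ g`.

For the enumerator identity, a form of degree at most q is determined by its values, so codewords
are forms, and the pairs split according to whether `f = 0`, `g = 0`, or a component is shared. The
bound q > 2 serves twice: degree 3 is then at most q, and each of two lines has three points off
their intersection. -/

namespace ConicCubic

open MvPolynomial

/-! ### Common components over the algebraic closure versus divisibility over the base field. -/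

section CommonComponents

attribute [local instance] MvPolynomial.algebraMvPolynomial

/-- Polynomial rings are flat under extension of the base field. -/
theorem flat_mvPolynomial {σ : Type*} (F K : Type*) [Field F] [Field K] [Algebra F K] :
    Module.Flat (MvPolynomial σ F) (MvPolynomial σ K) :=
  Module.Flat.isBaseChange F (MvPolynomial σ F) K (MvPolynomial σ K)
    (Algebra.IsPushout.out (R := F) (S := MvPolynomial σ F) (R' := K) (S' := MvPolynomial σ K))

/-- Going down for the flat extension F[x] → K[x]: the prime (h) contracts to a prime containing
(f), so some prime P ⊆ (h) lies over (f). P is nonzero, hence contains a prime element; it is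
divisible by `h`, thus associated to it. So h ∈ P, and `g` lies in P ∩ F[x] = (f). -/
theorem dvd_of_irreducible_dvd_map {σ F K : Type*} [Field F] [Field K] [Algebra F K]
    {f g : MvPolynomial σ F} (hf : Irreducible f) {h : MvPolynomial σ K} (hh : Irreducible h)
    (h1 : h ∣ map (algebraMap F K) f) (h2 : h ∣ map (algebraMap F K) g) : f ∣ g := by
  have := flat_mvPolynomial (σ := σ) F K
  have hprime : (Ideal.span {h}).IsPrime :=
    (Ideal.span_singleton_prime hh.ne_zero).2 hh.prime
  have hfp : (Ideal.span {f}).IsPrime := (Ideal.span_singleton_prime hf.ne_zero).2 hf.prime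
  have hle : Ideal.span {f} ≤ (Ideal.span {h}).under (MvPolynomial σ F) := by
    rw [Ideal.span_singleton_le_iff_mem, Ideal.under, Ideal.mem_comap,
      Ideal.mem_span_singleton]
    exact h1
  obtain ⟨P, hPle, hP, hlies⟩ := Ideal.exists_ideal_le_liesOver_of_le (Ideal.span {h}) hle
  have hmemP : map (algebraMap F K) f ∈ P := by
    have : f ∈ P.under (MvPolynomial σ F) := by
      rw [← hlies.over]
      exact Ideal.mem_span_singleton_self f
    exact this
  have hPne : P ≠ ⊥ := by
    rintro rfl
    have : map (algebraMap F K) f = 0 := hmemP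
    exact hf.ne_zero (map_injective _ (algebraMap F K).injective (by simpa using this))
  obtain ⟨π, hπP, hπ⟩ := hP.exists_mem_prime_of_ne_bot hPne
  have hd : h ∣ π := Ideal.mem_span_singleton.1 (hPle hπP)
  have hhP : h ∈ P :=
    Ideal.mem_of_dvd P ((hh.associated_of_dvd hπ.irreducible hd).symm.dvd) hπP
  have hgP : g ∈ P.under (MvPolynomial σ F) := by
    have : map (algebraMap F K) g ∈ P := Ideal.mem_of_dvd P h2 hhP
    exact this
  rw [← hlies.over] at hgP
  exact Ideal.mem_span_singleton.1 hgP

variable {F : Type*} [Field F]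

theorem not_isUnit_map {K : Type*} [Field K] [Algebra F K] {σ : Type*} {f : MvPolynomial σ F}
    (hf : ¬ IsUnit f) : ¬ IsUnit (map (algebraMap F K) f) := by
  intro h
  rw [isUnit_iff_totalDegree_of_isReduced] at h
  apply hf
  rw [isUnit_iff_totalDegree_of_isReduced]
  refine ⟨?_, ?_⟩
  · have := h.1
    rw [coeff_map] at this
    simpa [isUnit_iff_ne_zero] using this
  · rw [← h.2]
    rw [totalDegree, totalDegree, support_map_of_injective _ (algebraMap F K).injective]

theorem shareComponent_iff_dvd {f g : MvPolynomial (Fin 3) F} (hf : Irreducible f) :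
    ShareComponent (n := 2) f g ↔ f ∣ g := by
  refine ⟨fun ⟨h, hh, h1, h2⟩ => dvd_of_irreducible_dvd_map hf hh h1 h2, fun h => ?_⟩
  have h0 : map (algebraMap F (AlgebraicClosure F)) f ≠ 0 := fun h0 => hf.ne_zero
    (map_injective _ (algebraMap F (AlgebraicClosure F)).injective (by simpa using h0))
  obtain ⟨p, hp, hpf⟩ := WfDvdMonoid.exists_irreducible_factor
    (not_isUnit_map (K := AlgebraicClosure F) hf.not_isUnit) h0
  exact ⟨p, hp, hpf, hpf.trans (map_dvd (map (algebraMap F (AlgebraicClosure F))) h)⟩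

theorem shareComponent_mul_iff {a b g : MvPolynomial (Fin 3) F} (ha : Irreducible a)
    (hb : Irreducible b) : ShareComponent (n := 2) (a * b) g ↔ a ∣ g ∨ b ∣ g := by
  rw [← shareComponent_iff_dvd ha, ← shareComponent_iff_dvd hb]
  constructor
  · rintro ⟨h, hh, h1, h2⟩
    rw [map_mul] at h1
    rcases hh.prime.dvd_or_dvd h1 with h1 | h1
    · exact Or.inl ⟨h, hh, h1, h2⟩
    · exact Or.inr ⟨h, hh, h1, h2⟩
  · rintro (⟨h, hh, h1, h2⟩ | ⟨h, hh, h1, h2⟩)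
    · exact ⟨h, hh, by rw [map_mul]; exact h1.mul_right _, h2⟩
    · exact ⟨h, hh, by rw [map_mul]; exact h1.mul_left _, h2⟩

end CommonComponents

section Forms

/-! ## Forms and vanishing conditions -/

/-- The ternary forms of degree `d`, with `0`. -/
abbrev forms (F : Type*) [Field F] (d : ℕ) : Submodule F (MvPolynomial (Fin 3) F) :=
  homogeneousSubmodule (Fin 3) F d

/-- The ternary forms of degree `d` that vanish at all points of `S`. -/
def formsThrough {F : Type*} [Field F] (d : ℕ) (S : Set (ℙ F (Fin 3 → F))) :
    Submodule F (MvPolynomial (Fin 3) F) where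
  carrier := {g | g ∈ forms F d ∧ ∀ p ∈ S, eval p.rep g = 0}
  add_mem' := fun ha hb => ⟨add_mem ha.1 hb.1, fun p hp => by
    rw [map_add, ha.2 p hp, hb.2 p hp, add_zero]⟩
  zero_mem' := ⟨zero_mem _, fun p _ => map_zero _⟩
  smul_mem' := fun c g hg => ⟨Submodule.smul_mem _ c hg.1, fun p hp => by
    rw [smul_eval, hg.2 p hp, mul_zero]⟩

/-- The points of `S` impose independent conditions on forms of degree `d`, in the form: each is
separated from the others by some form. -/
def Separated {F : Type*} [Field F] (d : ℕ) (S : Set (ℙ F (Fin 3 → F))) : Prop :=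
  ∀ p ∈ S, ∃ g ∈ forms F d, eval p.rep g ≠ 0 ∧ ∀ a ∈ S, a ≠ p → eval a.rep g = 0

theorem Separated.mono {F : Type*} [Field F] {d : ℕ} {S T : Set (ℙ F (Fin 3 → F))}
    (hT : Separated d T) (h : S ⊆ T) : Separated d S := fun p hp => by
  obtain ⟨g, hg, h1, h2⟩ := hT p (h hp)
  exact ⟨g, hg, h1, fun a ha => h2 a (h ha)⟩

variable {F : Type*} [Field F]

theorem mul_mem_forms {a b : ℕ} {f g : MvPolynomial (Fin 3) F} (hf : f ∈ forms F a)
    (hg : g ∈ forms F b) : f * g ∈ forms F (a + b) :=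
  homogeneousSubmodule_mul a b (Submodule.mul_mem_mul hf hg)

/-! ## Separating points by products of linear forms -/

theorem exists_linear_eval_ne_zero (p : ℙ F (Fin 3 → F)) :
    ∃ l ∈ forms F 1, eval p.rep l ≠ 0 := by
  obtain ⟨i, hi⟩ : ∃ i, p.rep i ≠ 0 := by
    by_contra! h
    exact p.rep_nonzero (funext h)
  exact ⟨X i, isHomogeneous_X F i, by simpa using hi⟩

theorem exists_linear_separating {p a : ℙ F (Fin 3 → F)} (h : p ≠ a) :
    ∃ l ∈ forms F 1, eval p.rep l ≠ 0 ∧ eval a.rep l = 0 := by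
  by_contra! H
  apply h
  -- The linear forms x_i a_j - x_j a_i vanish at `a`; if all of them vanish at `p` too, the two
  -- vectors are proportional.
  have H' : ∀ i j, p.rep i * a.rep j = p.rep j * a.rep i := fun i j => by
    by_contra hne
    refine H (X i * C (a.rep j) - X j * C (a.rep i)) ?_ ?_ ?_
    · exact sub_mem (by simpa using mul_mem_forms (isHomogeneous_X F i) (isHomogeneous_C _ _))
        (by simpa using mul_mem_forms (isHomogeneous_X F j) (isHomogeneous_C _ _))
    · simpa [sub_eq_zero] using hne
    · simp [mul_comm]
  obtain ⟨i, hi⟩ : ∃ i, a.rep i ≠ 0 := by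
    by_contra! h
    exact a.rep_nonzero (funext h)
  rw [← p.mk_rep, ← a.mk_rep, Projectivization.mk_eq_mk_iff']
  refine ⟨p.rep i / a.rep i, ?_⟩
  ext j
  simp only [Pi.smul_apply, smul_eq_mul]
  field_simp
  rw [H' i j, mul_comm]

/-! ## Dimension counts -/

theorem card_forms (d : ℕ) : Nat.card (forms F d) = Nat.card F ^ (d + 2).choose 2 := by
  classical
  let A := Finset.finsuppAntidiag (Finset.univ : Finset (Fin 3)) d
  have hA : ∀ m : Fin 3 →₀ ℕ, m ∈ A ↔ m.degree = d := fun m => by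
    simp [A, Finset.mem_finsuppAntidiag, Finsupp.degree_eq_sum]
  have hcard : A.card = (d + 2).choose 2 := by
    rw [Finset.card_finsuppAntidiag_nat_eq_choose]
    rw [Finset.card_univ, Fintype.card_fin, ← Nat.choose_symm_add]
    congr 1
    omega
  let e : forms F d ≃ (A → F) :=
    { toFun := fun p m => coeff m.1 p.1
      invFun := fun c => ⟨∑ m : A, monomial m.1 (c m), Submodule.sum_mem _ fun m _ =>
        isHomogeneous_monomial _ ((hA _).1 m.2)⟩
      left_inv := fun p => by
        apply Subtype.ext
        ext m
        simp only [coeff_sum, coeff_monomial]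
        by_cases hm : m ∈ A
        · rw [Finset.sum_eq_single ⟨m, hm⟩] <;> simp +contextual [Subtype.ext_iff]
        · rw [Finset.sum_eq_zero]
          · symm
            by_contra h
            exact hm ((hA m).2 (by
              have := p.2 h
              rwa [show (1 : Fin 3 → ℕ) = fun _ => 1 from rfl, ← Finsupp.degree_eq_weight_one] at this))
          · intro x _
            rw [if_neg]
            rintro rfl
            exact hm x.2
      right_inv := fun c => by
        ext m
        simp only [coeff_sum, coeff_monomial]
        rw [Finset.sum_eq_single m]
        · simp
        · intro b _ hb
          rw [if_neg (fun h => hb (Subtype.ext h))]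
        · simp }
  rw [Nat.card_congr e, Nat.card_fun]
  simp [hcard]

variable [Finite F]

instance finite_forms (d : ℕ) : Finite (forms F d) := by
  have : Module.Finite F (forms F d) :=
    Module.Finite.iff_fg.2 (homogeneousSubmodule_fg (Fin 3) F d)
  exact Module.finite_of_finite F

theorem finite_forms_set (d : ℕ) : (forms F d : Set (MvPolynomial (Fin 3) F)).Finite :=
  Set.finite_coe_iff.1 (finite_forms d)

/-- Rescaled separating forms map to the standard basis, so evaluation on `S` is surjective and its
kernel has the expected size. -/
theorem Separated.card_formsThrough {d : ℕ} {S : Set (ℙ F (Fin 3 → F))} (hS : Separated d S) :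
    Nat.card (formsThrough d S) * Nat.card F ^ S.ncard = Nat.card (forms F d) := by
  classical
  let Φ : forms F d →ₗ[F] (S → F) :=
    LinearMap.pi fun p => (aeval p.1.rep).toLinearMap ∘ₗ (forms F d).subtype
  have hΦ : ∀ g p, Φ g p = eval p.1.rep g.1 := fun g p => by simp [Φ, aeval_eq_eval]
  have hsurj : Function.Surjective Φ := by
    rw [← LinearMap.range_eq_top, eq_top_iff, ← (Pi.basisFun F S).span_eq, Submodule.span_le]
    rintro _ ⟨p, rfl⟩
    obtain ⟨g, hg, h1, h2⟩ := hS p.1 p.2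
    refine ⟨(eval p.1.rep g)⁻¹ • ⟨g, hg⟩, ?_⟩
    ext a
    rw [map_smul, Pi.smul_apply, hΦ, Pi.basisFun_apply]
    by_cases hap : a = p
    · subst hap
      simp [h1]
    · rw [h2 a a.2 (fun h => hap (Subtype.ext h)), Pi.single_eq_of_ne hap, smul_zero]
  have e : LinearMap.ker Φ ≃ formsThrough d S :=
    { toFun := fun g => ⟨g.1.1, g.1.2, fun p hp => by
        rw [← hΦ g.1 ⟨p, hp⟩, LinearMap.mem_ker.1 g.2, Pi.zero_apply]⟩
      invFun := fun g => ⟨⟨g.1, g.2.1⟩, by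
        rw [LinearMap.mem_ker]
        ext p
        rw [hΦ]
        exact g.2.2 p.1 p.2⟩
      left_inv := fun g => rfl
      right_inv := fun g => rfl }
  have h1 := Submodule.card_eq_card_quotient_mul_card (LinearMap.ker Φ)
  rw [Nat.card_congr (Φ.quotKerEquivOfSurjective hsurj).toEquiv, Nat.card_fun, Nat.card_congr e,
    Nat.card_coe_set_eq] at h1
  exact h1.symm

/-- The multiples of `f` form a subspace of the forms through `S`. By `hcard` and independence both
spaces have as many elements as the forms of degree `b`, so they coincide. -/
theorem formsThrough_eq_map {a b : ℕ} {S : Set (ℙ F (Fin 3 → F))} (hS : Separated (a + b) S)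
    {f : MvPolynomial (Fin 3) F} (hf : f ∈ forms F a) (hf0 : f ≠ 0)
    (hfS : ∀ p ∈ S, eval p.rep f = 0)
    (hcard : (b + 2).choose 2 + S.ncard = (a + b + 2).choose 2) {g : MvPolynomial (Fin 3) F} :
    g ∈ formsThrough (a + b) S ↔ ∃ h ∈ forms F b, g = f * h := by
  have hfin : Finite (formsThrough (F := F) (a + b) S) :=
    ((finite_forms_set (a + b)).subset fun g hg => hg.1).to_subtype
  have hle : (forms F b).map (LinearMap.mulLeft F f) ≤ formsThrough (a + b) S := by
    rintro _ ⟨h, hh, rfl⟩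
    refine ⟨mul_mem_forms hf hh, fun p hp => ?_⟩
    simp [hfS p hp]
  have hc1 : Nat.card ((forms F b).map (LinearMap.mulLeft F f)) = Nat.card (forms F b) :=
    (Nat.card_congr (Submodule.equivMapOfInjective (LinearMap.mulLeft F f)
      (mul_right_injective₀ hf0) (forms F b)).toEquiv).symm
  have hc2 : Nat.card (formsThrough (F := F) (a + b) S) = Nat.card (forms F b) := by
    have h := hS.card_formsThrough
    rw [card_forms, ← hcard, pow_add, ← card_forms] at h
    exact Nat.eq_of_mul_eq_mul_right (pow_pos Nat.card_pos _) h
  have heq : ((forms F b).map (LinearMap.mulLeft F f) : Set _) = formsThrough (F := F) (a + b) S :=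
    Set.eq_of_subset_of_ncard_le hle (by
      rw [← Nat.card_coe_set_eq, ← Nat.card_coe_set_eq]
      exact (hc2.trans hc1.symm).le) (Set.toFinite _)
  rw [← SetLike.mem_coe, ← heq]
  simp only [Submodule.map_coe, Set.mem_image, SetLike.mem_coe, LinearMap.mulLeft_apply]
  exact exists_congr fun h => and_congr_right fun _ => eq_comm

end Forms

/-! ### Products of lines, and the zeros of a linear form. -/

section LinearForms

variable {F : Type*} [Field F]

/-- The form is a product of `n` lines missing `p`, each used to kill up to `m` of the points. -/
theorem exists_form_of_cover (p : ℙ F (Fin 3 → F)) (m n : ℕ) (R : Finset (ℙ F (Fin 3 → F)))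
    (hR : R.card ≤ m * n)
    (h : ∀ T ⊆ R, T.card ≤ m → ∃ l ∈ forms F 1, eval p.rep l ≠ 0 ∧ ∀ a ∈ T, eval a.rep l = 0) :
    ∃ g ∈ forms F n, eval p.rep g ≠ 0 ∧ ∀ a ∈ R, eval a.rep g = 0 := by
  classical
  induction n generalizing R with
  | zero =>
    have : R = ∅ := by simpa using hR
    subst this
    exact ⟨1, isHomogeneous_one _ _, by simp, by simp⟩
  | succ n ih =>
    obtain ⟨T, hTR, hT, hRT⟩ : ∃ T ⊆ R, T.card ≤ m ∧ (R \ T).card ≤ m * n := by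
      rcases le_total R.card m with h | h
      · exact ⟨R, subset_rfl, h, by simp⟩
      · obtain ⟨T, hTR, hT⟩ := Finset.exists_subset_card_eq h
        refine ⟨T, hTR, hT.le, ?_⟩
        rw [Finset.card_sdiff_of_subset hTR, hT]
        rw [mul_add, mul_one] at hR
        omega
    obtain ⟨l, hl, hlp, hlT⟩ := h T hTR hT
    obtain ⟨g, hg, hgp, hgR⟩ := ih (R \ T) hRT
      (fun T' hT' => h T' (hT'.trans Finset.sdiff_subset))
    refine ⟨g * l, mul_mem_forms hg hl, by simp [hgp, hlp], fun a ha => ?_⟩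
    by_cases haT : a ∈ T
    · simp [hlT a haT]
    · simp [hgR a (Finset.mem_sdiff.2 ⟨ha, haT⟩)]

/-- One line for each of the at most `d` other points. -/
theorem separated_of_card_le {d : ℕ} (S : Finset (ℙ F (Fin 3 → F))) (hS : S.card ≤ d + 1) :
    Separated d (S : Set (ℙ F (Fin 3 → F))) := by
  classical
  intro p hp
  obtain ⟨g, hg, hgp, hgR⟩ := exists_form_of_cover p 1 d (S.erase p)
    (by rw [Finset.card_erase_of_mem hp]; omega) (fun T hT hT1 => by
      rcases Finset.card_le_one_iff_subset_singleton.1 hT1 with ⟨a, ha⟩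
      rcases Finset.subset_singleton_iff.1 ha with rfl | rfl
      · obtain ⟨l, hl, h⟩ := exists_linear_eval_ne_zero p
        exact ⟨l, hl, h, by simp⟩
      · have : p ≠ a := by
          rintro rfl
          simp at hT
        obtain ⟨l, hl, h1, h2⟩ := exists_linear_separating this
        exact ⟨l, hl, h1, by simpa using h2⟩)
  exact ⟨g, hg, hgp, fun a ha hap => hgR a (Finset.mem_erase.2 ⟨hap, ha⟩)⟩

theorem not_isUnit_of_mem_forms {d : ℕ} (hd : d ≠ 0) {f : MvPolynomial (Fin 3) F}
    (hf : f ∈ forms F d) : ¬ IsUnit f := fun h => by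
  have h0 := (isUnit_iff_totalDegree_of_isReduced.1 h).2
  rw [IsHomogeneous.totalDegree hf h.ne_zero] at h0
  exact hd h0

theorem irreducible_linear {l : MvPolynomial (Fin 3) F} (hl : l ∈ forms F 1) (h0 : l ≠ 0) :
    Irreducible l := by
  refine irreducible_of_totalDegree_eq_one (IsHomogeneous.totalDegree hl h0) fun x hx => ?_
  rw [isUnit_iff_ne_zero]
  rintro rfl
  exact h0 (by ext i; simpa using hx i)

/-- A linear form as a linear functional. -/
theorem exists_linearMap_eq_eval {l : MvPolynomial (Fin 3) F} (hl : l ∈ forms F 1) :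
    ∃ φ : (Fin 3 → F) →ₗ[F] F, ∀ v, φ v = eval v l := by
  rw [forms, homogeneousSubmodule_one_eq_span_X] at hl
  induction hl using Submodule.span_induction with
  | mem x hx =>
    obtain ⟨i, rfl⟩ := hx
    exact ⟨LinearMap.proj i, fun v => by simp⟩
  | zero => exact ⟨0, by simp⟩
  | add x y _ _ hx hy =>
    obtain ⟨φ, hφ⟩ := hx
    obtain ⟨ψ, hψ⟩ := hy
    exact ⟨φ + ψ, fun v => by simp [hφ, hψ]⟩
  | smul a x _ hx =>
    obtain ⟨φ, hφ⟩ := hx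
    exact ⟨a • φ, fun v => by simp [hφ, smul_eval]⟩

/-- The zeros of a form in the projective plane. -/
def zeros (f : MvPolynomial (Fin 3) F) : Set (ℙ F (Fin 3 → F)) := {p | eval p.rep f = 0}

theorem mem_zeros {f : MvPolynomial (Fin 3) F} {p : ℙ F (Fin 3 → F)} :
    p ∈ zeros f ↔ eval p.rep f = 0 := Iff.rfl

theorem zeros_mul (f g : MvPolynomial (Fin 3) F) : zeros (f * g) = zeros f ∪ zeros g := by
  ext p
  simp [mem_zeros]

theorem eval_smul_of_mem_forms {d : ℕ} {f : MvPolynomial (Fin 3) F} (hf : f ∈ forms F d) (c : F)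
    (v : Fin 3 → F) : eval (c • v) f = c ^ d * eval v f := by
  rw [eval_eq, eval_eq, Finset.mul_sum]
  refine Finset.sum_congr rfl fun m hm => ?_
  have : ∑ i, m i = d := by
    rw [← Finsupp.degree_eq_sum, Finsupp.degree_eq_weight_one]
    exact hf (mem_support_iff.1 hm)
  have h2 : ∀ w : Fin 3 → F, ∏ i ∈ m.support, w i ^ m i = ∏ i, w i ^ m i := fun w =>
    Finset.prod_subset (Finset.subset_univ _) fun i _ hi => by
      rw [Finsupp.notMem_support_iff.1 hi, pow_zero]
  rw [h2, h2, ← this, ← Finset.prod_pow_eq_pow_sum]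
  simp only [Pi.smul_apply, smul_eq_mul, mul_pow, Finset.prod_mul_distrib]
  ring

theorem mk_mem_zeros {d : ℕ} {f : MvPolynomial (Fin 3) F} (hf : f ∈ forms F d) {v : Fin 3 → F}
    (hv : v ≠ 0) : Projectivization.mk F v hv ∈ zeros f ↔ eval v f = 0 := by
  obtain ⟨a, ha⟩ := Projectivization.exists_smul_eq_mk_rep F v hv
  rw [mem_zeros, ← ha, Units.smul_def, eval_smul_of_mem_forms hf]
  simp

theorem exists_mem_zeros_inter {l m : MvPolynomial (Fin 3) F} (hl : l ∈ forms F 1)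
    (hm : m ∈ forms F 1) : ∃ p, p ∈ zeros l ∧ p ∈ zeros m := by
  obtain ⟨φ, hφ⟩ := exists_linearMap_eq_eval hl
  obtain ⟨ψ, hψ⟩ := exists_linearMap_eq_eval hm
  have h : LinearMap.ker (φ.prod ψ) ≠ ⊥ := LinearMap.ker_ne_bot_of_finrank_lt (by simp)
  obtain ⟨v, hv, hv0⟩ := Submodule.exists_mem_ne_zero_of_ne_bot h
  rw [LinearMap.ker_prod, Submodule.mem_inf, LinearMap.mem_ker, LinearMap.mem_ker] at hv
  exact ⟨Projectivization.mk F v hv0, (mk_mem_zeros hl hv0).2 (hφ v ▸ hv.1),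
    (mk_mem_zeros hm hv0).2 (hψ v ▸ hv.2)⟩

variable [Finite F]

/-- The nonzero vectors of the affine cone are the `q - 1` multiples of each projective zero; the
final `+ 1` is the origin. -/
theorem card_eval_eq_zero {d : ℕ} (hd : d ≠ 0) {f : MvPolynomial (Fin 3) F} (hf : f ∈ forms F d) :
    Nat.card {v : Fin 3 → F // eval v f = 0} = (zeros f).ncard * (Nat.card F - 1) + 1 := by
  classical
  have h0 : eval (0 : Fin 3 → F) f = 0 := by
    have := eval_smul_of_mem_forms hf 0 0
    rwa [zero_smul, zero_pow hd, zero_mul] at this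
  let Φ : zeros f × Fˣ → {v : {v : Fin 3 → F // eval v f = 0} // v ≠ ⟨0, h0⟩} := fun x =>
    ⟨⟨(x.2 : F) • x.1.1.rep, by
      rw [eval_smul_of_mem_forms hf, mem_zeros.1 x.1.2, mul_zero]⟩, fun h => by
      have := congrArg Subtype.val h
      rcases smul_eq_zero.1 this with h | h
      · exact x.2.ne_zero h
      · exact x.1.1.rep_nonzero h⟩
  have hΦ : Function.Bijective Φ := by
    constructor
    · rintro ⟨⟨p, hp⟩, u⟩ ⟨⟨p', hp'⟩, u'⟩ h
      have h1 : (u : F) • p.rep = (u' : F) • p'.rep :=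
        congrArg (fun x => (x.1.1 : Fin 3 → F)) h
      have h2 : p = p' := by
        rw [← p.mk_rep, ← p'.mk_rep, Projectivization.mk_eq_mk_iff']
        refine ⟨(u : F)⁻¹ * u', ?_⟩
        rw [mul_smul, ← h1, smul_smul, inv_mul_cancel₀ u.ne_zero, one_smul]
      subst h2
      have := smul_left_injective F p.rep_nonzero h1
      simp [Units.ext this]
    · rintro ⟨⟨v, hv⟩, hv0⟩
      have hv0' : v ≠ 0 := fun h => hv0 (Subtype.ext h)
      obtain ⟨a, ha⟩ := Projectivization.exists_smul_eq_mk_rep F v hv0'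
      refine ⟨⟨⟨_, (mk_mem_zeros hf hv0').2 hv⟩, a⁻¹⟩, ?_⟩
      apply Subtype.ext
      apply Subtype.ext
      change (a⁻¹ : Fˣ) • (Projectivization.mk F v hv0').rep = v
      rw [← ha, inv_smul_smul]
  have h1 := Nat.card_congr (Equiv.ofBijective Φ hΦ)
  rw [Nat.card_prod, Nat.card_units, Nat.card_coe_set_eq] at h1
  have := Fintype.ofFinite F
  rw [h1, Nat.card_eq_fintype_card, Nat.card_eq_fintype_card, Fintype.card_subtype_compl,
    Fintype.card_subtype_eq]
  have : 0 < Fintype.card {v : Fin 3 → F // eval v f = 0} := Fintype.card_pos_iff.2 ⟨⟨0, h0⟩⟩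
  omega

/-- Any `d + 2` points are independent in degree `d + 1`, and C(d+2, 2) + (d+2) = C(d+3, 2), so
`formsThrough_eq_map` applies to `l`. -/
theorem eq_mul_of_zeros_on_line {d : ℕ} {l g : MvPolynomial (Fin 3) F} (hl : l ∈ forms F 1)
    (hl0 : l ≠ 0) (T : Finset (ℙ F (Fin 3 → F))) (hT : T.card = d + 2)
    (hTl : ∀ p ∈ T, p ∈ zeros l) (hg : g ∈ forms F (1 + d)) (hTg : ∀ p ∈ T, p ∈ zeros g) :
    ∃ h ∈ forms F d, g = l * h := by
  refine (formsThrough_eq_map (S := (T : Set _)) (separated_of_card_le T (by omega)) hl hl0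
    hTl ?_).1 ⟨hg, hTg⟩
  rw [Set.ncard_coe_finset, hT, show 1 + d + 2 = (d + 2) + 1 by ring, Nat.choose_succ_succ' (d + 2),
    Nat.choose_one_right, add_comm]

theorem exists_line_through {a b : ℙ F (Fin 3 → F)} (hab : a ≠ b) :
    ∃ l ∈ forms F 1, l ≠ 0 ∧ a ∈ zeros l ∧ b ∈ zeros l := by
  classical
  let S : Finset (ℙ F (Fin 3 → F)) := {a, b}
  have hS : S.card = 2 := Finset.card_pair hab
  have h := (separated_of_card_le (d := 1) S hS.le).card_formsThrough
  rw [Set.ncard_coe_finset, hS, card_forms] at h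
  have hq : 1 < Nat.card F := Finite.one_lt_card
  have h2 : Nat.card (formsThrough 1 (S : Set (ℙ F (Fin 3 → F)))) = Nat.card F := by
    have : Nat.card F ^ Nat.choose (1 + 2) 2 = Nat.card F * Nat.card F ^ 2 := by
      rw [show Nat.choose (1 + 2) 2 = 3 from rfl]; ring
    rw [this] at h
    exact Nat.eq_of_mul_eq_mul_right (by positivity) h
  have : Nontrivial (formsThrough 1 (S : Set (ℙ F (Fin 3 → F)))) := by
    have := Nat.finite_of_card_ne_zero (by omega :
      Nat.card (formsThrough 1 (S : Set (ℙ F (Fin 3 → F)))) ≠ 0)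
    rw [← Finite.one_lt_card_iff_nontrivial, h2]
    exact hq
  obtain ⟨⟨l, hl⟩, hl0⟩ := exists_ne (0 : formsThrough 1 (S : Set (ℙ F (Fin 3 → F))))
  exact ⟨l, hl.1, fun h => hl0 (Subtype.ext h), hl.2 a (by simp [S]), hl.2 b (by simp [S])⟩

theorem ncard_zeros_linear {l : MvPolynomial (Fin 3) F} (hl : l ∈ forms F 1) (hl0 : l ≠ 0) :
    (zeros l).ncard = Nat.card F + 1 := by
  obtain ⟨φ, hφ⟩ := exists_linearMap_eq_eval hl
  have hq : 1 < Nat.card F := Finite.one_lt_card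
  have hφ0 : φ ≠ 0 := by
    rintro rfl
    refine hl0 (IsHomogeneous.eq_zero_of_forall_eval_eq_zero_of_le_card hl
      (fun v => (hφ v).symm) ?_)
    rw [← Nat.cast_card, Nat.cast_le]
    exact hq.le
  have h1 := Submodule.card_eq_card_quotient_mul_card (LinearMap.ker φ)
  rw [Nat.card_congr (φ.quotKerEquivOfSurjective (LinearMap.surjective hφ0)).toEquiv,
    Nat.card_fun, Nat.card_fin] at h1
  have h2 : Nat.card (LinearMap.ker φ) = Nat.card {v : Fin 3 → F // eval v l = 0} :=
    Nat.card_congr (Equiv.subtypeEquivRight fun v => by rw [LinearMap.mem_ker, hφ])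
  rw [h2, card_eval_eq_zero one_ne_zero hl] at h1
  obtain ⟨r, hr⟩ : ∃ r, Nat.card F = r + 2 := ⟨_, (Nat.sub_add_cancel hq).symm⟩
  rw [hr] at h1 ⊢
  have h3 : (zeros l).ncard * (r + 1) + 1 = (r + 2) ^ 2 := by
    apply Nat.eq_of_mul_eq_mul_right (show 0 < r + 2 by omega)
    rw [show r + 1 = r + 2 - 1 by omega, ← h1]
    ring
  apply Nat.eq_of_mul_eq_mul_right (show 0 < r + 1 by omega)
  nlinarith

end LinearForms

/-! ### Irreducible conics: their points and the conditions these impose. -/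

section Conics

variable {F : Type*} [Field F]

theorem eq_add_of_totalDegree_eq_one {a : MvPolynomial (Fin 3) F} (ha : a.totalDegree = 1) :
    ∃ b ∈ forms F 0, ∃ c ∈ forms F 1, a = b + c := by
  refine ⟨_, homogeneousComponent_isHomogeneous 0 a, _, homogeneousComponent_isHomogeneous 1 a, ?_⟩
  conv_lhs => rw [← sum_homogeneousComponent a, ha]
  simp [Finset.sum_range_succ]

/-- In a nontrivial factorisation both factors have degree 1, possibly with constant terms; the
degree 2 component shows that the product of their linear parts is already `f`. -/
theorem irreducible_or_eq_mul {f : MvPolynomial (Fin 3) F} (hf : f ∈ forms F 2) (hf0 : f ≠ 0) :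
    Irreducible f ∨ ∃ l ∈ forms F 1, ∃ m ∈ forms F 1, f = l * m := by
  by_contra! H
  obtain ⟨H1, H2⟩ := H
  apply H1
  refine ⟨not_isUnit_of_mem_forms two_ne_zero hf, fun a b hab => ?_⟩
  by_contra! hu
  have ha0 : a ≠ 0 := by rintro rfl; simp at hab; exact hf0 hab
  have hb0 : b ≠ 0 := by rintro rfl; simp at hab; exact hf0 hab
  have hdeg := IsHomogeneous.totalDegree hf hf0
  rw [hab, totalDegree_mul_of_isDomain ha0 hb0] at hdeg
  have key : ∀ c : MvPolynomial (Fin 3) F, c ≠ 0 → ¬ IsUnit c → c.totalDegree ≠ 0 := by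
    intro c hc hcu h
    apply hcu
    rw [totalDegree_eq_zero_iff_eq_C.1 h] at hc ⊢
    exact (isUnit_iff_ne_zero.2 fun h0 => hc (by rw [h0, map_zero])).map C
  have h1 := key a ha0 hu.1
  have h2 := key b hb0 hu.2
  obtain ⟨a0, ha0', a1, ha1, rfl⟩ := eq_add_of_totalDegree_eq_one (a := a) (by omega)
  obtain ⟨b0, hb0', b1, hb1, rfl⟩ := eq_add_of_totalDegree_eq_one (a := b) (by omega)
  refine H2 a1 ha1 b1 hb1 ?_
  have h := homogeneousComponent_of_mem (m := 2) hf
  rw [if_pos rfl, hab, show (a0 + a1) * (b0 + b1) = a0 * b0 + (a0 * b1 + (a1 * b0 + a1 * b1)) by ring,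
    map_add, map_add, map_add, homogeneousComponent_of_mem (mul_mem_forms ha0' hb0'),
    homogeneousComponent_of_mem (mul_mem_forms ha0' hb1),
    homogeneousComponent_of_mem (mul_mem_forms ha1 hb0'),
    homogeneousComponent_of_mem (mul_mem_forms ha1 hb1)] at h
  rw [hab, show (a0 + a1) * (b0 + b1) = a0 * b0 + (a0 * b1 + (a1 * b0 + a1 * b1)) by ring]
  simpa using h.symm

/-- The polar form of a quadratic form at a fixed vector. -/
theorem exists_polar {f : MvPolynomial (Fin 3) F} (hf : f ∈ forms F 2) (v : Fin 3 → F) :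
    ∃ φ : (Fin 3 → F) →ₗ[F] F, ∀ w t, eval (w + t • v) f =
      eval w f + t * φ w + t ^ 2 * eval v f := by
  rw [forms, ← homogeneousSubmodule_one_pow, pow_two] at hf
  induction hf using Submodule.mul_induction_on' with
  | mem_mul_mem l hl m hm =>
    obtain ⟨φ, hφ⟩ := exists_linearMap_eq_eval hl
    obtain ⟨ψ, hψ⟩ := exists_linearMap_eq_eval hm
    refine ⟨φ v • ψ + ψ v • φ, fun w t => ?_⟩
    simp only [map_mul, ← hφ, ← hψ, map_add, map_smul, LinearMap.add_apply, LinearMap.smul_apply,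
      smul_eq_mul]
    ring
  | add x _ y _ hx hy =>
    obtain ⟨φ, hφ⟩ := hx
    obtain ⟨ψ, hψ⟩ := hy
    refine ⟨φ + ψ, fun w t => ?_⟩
    simp only [map_add, hφ, hψ, LinearMap.add_apply]
    ring

theorem not_irreducible_mul {d e : ℕ} (hd : d ≠ 0) (he : e ≠ 0) {f g : MvPolynomial (Fin 3) F}
    (hf : f ∈ forms F d) (hg : g ∈ forms F e) : ¬ Irreducible (f * g) := fun h => by
  rcases h.isUnit_or_isUnit rfl with h | h
  · exact not_isUnit_of_mem_forms hd hf h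
  · exact not_isUnit_of_mem_forms he hg h

/-- Each translation by `t • v` permutes the vectors; sum over `t` and swap the sums. -/
theorem card_mul_card_eq_sum [Fintype F] (P : (Fin 3 → F) → Prop) (v : Fin 3 → F)  :
    Nat.card F * Nat.card {w // P w} = ∑ w : Fin 3 → F, Nat.card {t : F // P (w + t • v)} := by
  classical
  simp only [Nat.card_eq_fintype_card, Fintype.card_subtype, Finset.card_filter]
  rw [Finset.sum_comm]
  have : ∀ t : F, ∑ w : Fin 3 → F, (if P (w + t • v) then 1 else 0) =
      ∑ w : Fin 3 → F, (if P w then 1 else 0) := fun t =>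
    Fintype.sum_equiv (Equiv.addRight (t • v)) _ _ fun w => rfl
  simp [this]

variable [Finite F]

/-- A line missing a zero of an irreducible conic and passing through two others. -/
theorem exists_line_through_of_irreducible {f : MvPolynomial (Fin 3) F} (hf : f ∈ forms F 2)
    (hirr : Irreducible f) {p : ℙ F (Fin 3 → F)} (hp : p ∈ zeros f) (T : Finset (ℙ F (Fin 3 → F)))
    (hT : ∀ a ∈ T, a ∈ zeros f) (hpT : p ∉ T) (hcard : T.card ≤ 2) :
    ∃ l ∈ forms F 1, eval p.rep l ≠ 0 ∧ ∀ a ∈ T, eval a.rep l = 0 := by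
  classical
  rcases Nat.lt_or_ge T.card 2 with h | h
  · obtain ⟨g, hg, h1, h2⟩ := separated_of_card_le (F := F) (d := 1) (insert p T)
      (by rw [Finset.card_insert_of_notMem hpT]; omega) p (by simp)
    exact ⟨g, hg, h1, fun a ha => h2 a (by simp [ha]) (by rintro rfl; exact hpT ha)⟩
  · obtain ⟨a, b, hab, rfl⟩ := Finset.card_eq_two.1 (le_antisymm hcard h)
    obtain ⟨l, hl, hl0, ha, hb⟩ := exists_line_through hab
    refine ⟨l, hl, fun hlp => ?_, by simpa using ⟨ha, hb⟩⟩
    -- Three collinear zeros would make the line a factor of the conic.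
    obtain ⟨m, hm, rfl⟩ := eq_mul_of_zeros_on_line (d := 1) hl hl0 (insert p {a, b})
      (by rw [Finset.card_insert_of_notMem hpT, Finset.card_pair hab])
      (by
        intro x hx
        simp only [Finset.mem_insert, Finset.mem_singleton] at hx
        rcases hx with rfl | rfl | rfl
        exacts [hlp, ha, hb]) hf (by
        intro x hx
        rcases Finset.mem_insert.1 hx with rfl | hx
        exacts [hp, hT x hx])
    exact not_irreducible_mul one_ne_zero one_ne_zero hl hm hirr

/-- No three zeros are collinear, so each of `d` lines can pass through two of the remaining `2 * d`
points while missing `p`. -/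
theorem separated_of_irreducible {f : MvPolynomial (Fin 3) F} (hf : f ∈ forms F 2)
    (hirr : Irreducible f) {d : ℕ} (S : Finset (ℙ F (Fin 3 → F))) (hS : ∀ a ∈ S, a ∈ zeros f)
    (hcard : S.card ≤ 2 * d + 1) : Separated d (S : Set (ℙ F (Fin 3 → F))) := by
  classical
  intro p hp
  obtain ⟨g, hg, h1, h2⟩ := exists_form_of_cover p 2 d (S.erase p)
    (by rw [Finset.card_erase_of_mem hp]; omega) (fun T hT hT2 =>
      exists_line_through_of_irreducible hf hirr (hS p hp) T
        (fun a ha => hS a (Finset.mem_of_mem_erase (hT ha)))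
        (fun h => Finset.notMem_erase p S (hT h)) hT2)
  exact ⟨g, hg, h1, fun a ha hap => h2 a (Finset.mem_erase.2 ⟨hap, ha⟩)⟩

/-- Seven points of an irreducible conic force a cubic to contain it. -/
theorem dvd_of_irreducible_of_seven {f g : MvPolynomial (Fin 3) F} (hf : f ∈ forms F 2)
    (hirr : Irreducible f) (hg : g ∈ forms F 3) (S : Finset (ℙ F (Fin 3 → F)))
    (hS : ∀ a ∈ S, a ∈ zeros f) (hSg : ∀ a ∈ S, a ∈ zeros g) (hcard : S.card = 7) : f ∣ g := by
  obtain ⟨h, _, rfl⟩ := (formsThrough_eq_map (a := 2) (b := 1) (S := (S : Set _))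
    (separated_of_irreducible hf hirr S hS hcard.le) hf hirr.ne_zero hS (by
      rw [Set.ncard_coe_finset, hcard]; rfl)).1 ⟨hg, hSg⟩
  exact dvd_mul_right f h

/-- Otherwise `v`, `w` and `w + v` represent three collinear zeros of an irreducible conic. -/
theorem mem_span_of_irreducible {f : MvPolynomial (Fin 3) F} (hf : f ∈ forms F 2)
    (hirr : Irreducible f) {v w : Fin 3 → F} (hv : v ≠ 0) (h : ∀ t : F, eval (w + t • v) f = 0)
    (hv0 : eval v f = 0) : ∃ t : F, w = t • v := by
  classical
  by_contra! H
  have hw : ∀ t : F, w + t • v ≠ 0 := fun t h0 => H (-t) (by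
    rw [neg_smul]; exact eq_neg_of_add_eq_zero_left h0)
  let P := Projectivization.mk F v hv
  let Q := fun t => Projectivization.mk F _ (hw t)
  have hPQ : ∀ t, P ≠ Q t := by
    intro t h
    obtain ⟨a, ha⟩ := (Projectivization.mk_eq_mk_iff' F _ _ _ _).1 h.symm
    exact H (a - t) (by rw [sub_smul, ha]; abel)
  have hQQ : Q 0 ≠ Q 1 := by
    intro h
    obtain ⟨a, ha⟩ := (Projectivization.mk_eq_mk_iff' F _ _ _ _).1 h
    rw [zero_smul, add_zero, one_smul, smul_add] at ha
    have h1 : (1 - a) • w = a • v := by rw [sub_smul, one_smul, sub_eq_iff_eq_add, add_comm]; exact ha.symm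
    by_cases ha1 : 1 - a = 0
    · rw [ha1, zero_smul, ← sub_eq_zero.1 ha1, one_smul] at h1
      exact hv h1.symm
    · exact H ((1 - a)⁻¹ * a) (by rw [mul_smul, ← h1, smul_smul, inv_mul_cancel₀ ha1, one_smul])
  have hPf : P ∈ zeros f := (mk_mem_zeros hf hv).2 hv0
  have hQf : ∀ t, Q t ∈ zeros f := fun t => (mk_mem_zeros hf (hw t)).2 (h t)
  obtain ⟨l, hl, h1, h2⟩ := exists_line_through_of_irreducible hf hirr (hQf 1) {P, Q 0}
    (by
      intro a ha
      simp only [Finset.mem_insert, Finset.mem_singleton] at ha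
      rcases ha with rfl | rfl
      exacts [hPf, hQf 0]) (by simp [(hPQ 1).symm, hQQ.symm]) Finset.card_le_two
  obtain ⟨φ, hφ⟩ := exists_linearMap_eq_eval hl
  have hlP : φ v = 0 := (hφ v).trans ((mk_mem_zeros hl hv).1 (h2 P (by simp)))
  have hlQ : φ (w + (0 : F) • v) = 0 :=
    (hφ _).trans ((mk_mem_zeros hl (hw 0)).1 (h2 (Q 0) (by simp)))
  refine h1 ((mk_mem_zeros hl (hw 1)).2 ?_)
  rw [← hφ]
  rw [zero_smul, add_zero] at hlQ
  rw [map_add, map_smul, hlP, hlQ, smul_zero, add_zero]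

theorem exists_mem_zeros_conic {f : MvPolynomial (Fin 3) F} (hf : f ∈ forms F 2) :
    ∃ v : Fin 3 → F, v ≠ 0 ∧ eval v f = 0 := by
  classical
  have := Fintype.ofFinite F
  obtain ⟨p, hp⟩ := CharP.exists F
  have hprime : p.Prime := (CharP.char_is_prime_or_zero F p).resolve_right
    (CharP.char_ne_zero_of_finite F p)
  -- Chevalley–Warning: degree 2 in three variables, so the trivial zero is not the only one.
  have hdvd := char_dvd_card_solutions p (f := f) (by
    have := IsHomogeneous.totalDegree_le hf
    simp only [Fintype.card_fin]
    omega)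
  have h0 : eval (0 : Fin 3 → F) f = 0 := by
    have := eval_smul_of_mem_forms hf 0 0
    rwa [zero_smul, zero_pow two_ne_zero, zero_mul] at this
  have hpos : 0 < Fintype.card {x : Fin 3 → F // eval x f = 0} := Fintype.card_pos_iff.2 ⟨⟨0, h0⟩⟩
  have h1 : 1 < Fintype.card {x : Fin 3 → F // eval x f = 0} :=
    lt_of_lt_of_le hprime.one_lt (Nat.le_of_dvd hpos hdvd)
  obtain ⟨v, hv⟩ := Fintype.exists_ne_of_one_lt_card h1 ⟨0, h0⟩
  exact ⟨v.1, fun h => hv (Subtype.ext h), v.2⟩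

/-- Count zeros on the lines parallel to a zero `v`, where f(w + tv) = f(w) + tφ(w). There is one
zero if φ(w) ≠ 0, none if φ(w) = 0 and `w` is outside the span of `v`, and `q` if `w` is in that
span. The affine count is thus `q` when φ = 0 and `q ^ 2` otherwise, that is, 1 or `q + 1`
projective points. The argument is uniform in the characteristic. -/
theorem ncard_zeros_of_irreducible {f : MvPolynomial (Fin 3) F} (hf : f ∈ forms F 2)
    (hirr : Irreducible f) : (zeros f).ncard = 1 ∨ (zeros f).ncard = Nat.card F + 1 := by
  classical
  have := Fintype.ofFinite F
  obtain ⟨v, hv, hv0⟩ := exists_mem_zeros_conic hf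
  obtain ⟨φ, hφ⟩ := exists_polar hf v
  have hq : 1 < Nat.card F := Finite.one_lt_card
  simp only [hv0, mul_zero, add_zero] at hφ
  have hspan : ∀ t : F, eval (t • v) f = 0 := fun t => by
    rw [eval_smul_of_mem_forms hf, hv0, mul_zero]
  have hφv : φ v = 0 := by
    have := hφ v 1
    rw [show v + (1 : F) • v = (2 : F) • v by module, hspan, hv0] at this
    simpa using this.symm
  have hfib : ∀ w : Fin 3 → F, Nat.card {t : F // eval (w + t • v) f = 0} =
      (if φ w = 0 then 0 else 1) + Nat.card F * (if ∃ t : F, w = t • v then 1 else 0) := by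
    intro w
    by_cases hw : ∃ t : F, w = t • v
    · obtain ⟨s, rfl⟩ := hw
      have : ∀ t : F, eval (s • v + t • v) f = 0 := fun t => by rw [← add_smul, hspan]
      simp only [this]
      have h2 : ∃ t : F, s • v = t • v := ⟨s, rfl⟩
      rw [if_pos h2, if_pos (by rw [map_smul, hφv, smul_zero]), zero_add, mul_one]
      exact Nat.card_congr (Equiv.subtypeUnivEquiv fun _ => trivial)
    · rw [if_neg hw, mul_zero, add_zero]
      simp only [hφ]
      by_cases hφw : φ w = 0
      · rw [if_pos hφw]
        have h1 : eval w f ≠ 0 := fun h0 => hw (mem_span_of_irreducible hf hirr hv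
          (fun t => by rw [hφ, h0, hφw]; ring) hv0)
        simp [hφw, h1]
      · rw [if_neg hφw, Nat.card_eq_one_iff_unique]
        refine ⟨⟨fun a b => Subtype.ext ?_⟩, ⟨⟨-eval w f / φ w, by field_simp; ring⟩⟩⟩
        have := a.2.trans b.2.symm
        exact mul_right_cancel₀ hφw (add_left_cancel this)
  have hsum := card_mul_card_eq_sum (fun w => eval w f = 0) v
  rw [Finset.sum_congr rfl fun w _ => hfib w, Finset.sum_add_distrib, ← Finset.mul_sum,
    card_eval_eq_zero two_ne_zero hf] at hsum
  have hs : ∑ w : Fin 3 → F, (if ∃ t : F, w = t • v then 1 else 0) = Nat.card F := by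
    rw [← Finset.card_filter, Nat.card_eq_fintype_card]
    refine (Finset.card_bij (fun t _ => t • v) ?_ ?_ ?_).symm
    · exact fun t _ => Finset.mem_filter.2 ⟨Finset.mem_univ _, t, rfl⟩
    · exact fun s _ t _ h => smul_left_injective F hv h
    · intro w hw
      obtain ⟨t, ht⟩ := (Finset.mem_filter.1 hw).2
      exact ⟨t, Finset.mem_univ _, ht.symm⟩
  rw [hs] at hsum
  obtain ⟨r, hr⟩ : ∃ r, Nat.card F = r + 2 := ⟨_, (Nat.sub_add_cancel hq).symm⟩
  by_cases hφ0 : φ = 0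
  · left
    simp only [hφ0, LinearMap.zero_apply, if_true, Finset.sum_const_zero, zero_add] at hsum
    have h := Nat.eq_of_mul_eq_mul_left (by omega) hsum
    rw [hr, show r + 2 - 1 = r + 1 by omega] at h
    apply Nat.eq_of_mul_eq_mul_right (show 0 < r + 1 by omega)
    omega
  · right
    have h1 := Submodule.card_eq_card_quotient_mul_card (LinearMap.ker φ)
    rw [Nat.card_congr (φ.quotKerEquivOfSurjective (LinearMap.surjective hφ0)).toEquiv,
      Nat.card_fun, Nat.card_fin] at h1
    have h2 : ∑ w : Fin 3 → F, (if φ w = 0 then 0 else 1) + Nat.card (LinearMap.ker φ) =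
        Nat.card F ^ 3 := by
      have h3 : Nat.card F ^ 3 = Fintype.card (Fin 3 → F) := by
        rw [← Nat.card_eq_fintype_card, Nat.card_fun, Nat.card_fin]
      rw [h3, Nat.card_congr (Equiv.subtypeEquivRight fun w => LinearMap.mem_ker :
          LinearMap.ker φ ≃ {w // φ w = 0}), Nat.card_eq_fintype_card, Fintype.card_subtype,
        Finset.card_filter, ← Finset.sum_add_distrib, Fintype.card_eq_sum_ones]
      refine Finset.sum_congr rfl fun w _ => ?_
      split_ifs <;> rfl
    rw [hr, show r + 2 - 1 = r + 1 by omega] at hsum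
    rw [hr] at h1 h2 ⊢
    have h3 : Nat.card (LinearMap.ker φ) = (r + 2) ^ 2 :=
      Nat.eq_of_mul_eq_mul_right (show 0 < r + 2 by omega) (by rw [← h1]; ring)
    rw [h3] at h2
    apply Nat.eq_of_mul_eq_mul_right (show 0 < (r + 1) * (r + 2) by positivity)
    nlinarith

end Conics

/-! ### Divisibility among forms. -/

section Divisibility

variable {F : Type*} [Field F]

theorem dvd_iff_exists_forms {a b : ℕ} {f g : MvPolynomial (Fin 3) F} (hf : f ∈ forms F a)
    (hg : g ∈ forms F (a + b)) : f ∣ g ↔ ∃ h ∈ forms F b, g = f * h := by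
  refine ⟨?_, fun ⟨h, _, e⟩ => ⟨h, e⟩⟩
  rintro ⟨h, rfl⟩
  refine ⟨_, homogeneousComponent_isHomogeneous b h, ?_⟩
  have h1 := homogeneousComponent_of_mem (m := a + b) hg
  rw [if_pos rfl] at h1
  rw [← h1]
  conv_lhs => rw [← sum_homogeneousComponent h, Finset.mul_sum, map_sum]
  have h2 : ∀ i, homogeneousComponent (a + b) (f * homogeneousComponent i h) =
      if b = i then f * homogeneousComponent i h else 0 := fun i => by
    rw [homogeneousComponent_of_mem (mul_mem_forms hf (homogeneousComponent_isHomogeneous i h))]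
    simp
  simp only [h2, Finset.sum_ite_eq, Finset.mem_range]
  split_ifs with hb
  · rfl
  · rw [homogeneousComponent_eq_zero b h (by omega), mul_zero]

theorem eq_zero_of_forms_zero {c : MvPolynomial (Fin 3) F} (hc : c ∈ forms F 0)
    {p : ℙ F (Fin 3 → F)} (hp : p ∈ zeros c) : c = 0 := by
  have h := totalDegree_eq_zero_iff_eq_C.1 ((totalDegree_zero_iff_isHomogeneous _).2 hc)
  rw [mem_zeros, h, eval_C] at hp
  rw [h, hp, map_zero]

theorem zeros_subset_of_dvd {f g : MvPolynomial (Fin 3) F} (h : f ∣ g) : zeros f ⊆ zeros g := by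
  obtain ⟨m, rfl⟩ := h
  rw [zeros_mul]
  exact Set.subset_union_left

end Divisibility

-- Double counting: each product of binomials counts the pairs (S, T) on which `g` satisfies `R`.
open scoped Classical in
theorem sum_choose_mul_choose {α β : Type*} (G : Finset α) (A B : Finset β) (R : α → β → Prop)
    (i k : ℕ) :
    ∑ g ∈ G, (A.filter (R g)).card.choose i * (B.filter (R g)).card.choose k =
      ∑ S ∈ A.powersetCard i, ∑ T ∈ B.powersetCard k,
        (G.filter fun g => ∀ p ∈ S ∪ T, R g p).card := by
  have key : ∀ (A : Finset β) (i : ℕ) (g : α), (A.filter (R g)).card.choose i =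
      ∑ S ∈ A.powersetCard i, if ∀ p ∈ S, R g p then 1 else 0 := fun A i g => by
    rw [← Finset.card_powersetCard, ← Finset.card_filter]
    congr 1
    ext S
    simp only [Finset.mem_powersetCard, Finset.mem_filter, Finset.subset_iff]
    constructor
    · exact fun h => ⟨⟨fun x hx => (h.1 hx).1, h.2⟩, fun x hx => (h.1 hx).2⟩
    · exact fun h => ⟨fun x hx => ⟨h.1.1 hx, h.2 x hx⟩, h.1.2⟩
  simp only [key, Finset.sum_mul_sum]
  simp only [Finset.card_filter]
  rw [Finset.sum_comm]
  refine Finset.sum_congr rfl fun S _ => ?_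
  rw [Finset.sum_comm]
  refine Finset.sum_congr rfl fun T _ => Finset.sum_congr rfl fun g _ => ?_
  simp only [Finset.mem_union, or_imp, forall_and]
  split_ifs <;> simp_all

open scoped Classical in
theorem sum_choose {α β : Type*} (G : Finset α) (A : Finset β) (R : α → β → Prop) (j : ℕ) :
    ∑ g ∈ G, (A.filter (R g)).card.choose j =
      ∑ S ∈ A.powersetCard j, (G.filter fun g => ∀ p ∈ S, R g p).card := by
  simpa using sum_choose_mul_choose G A ∅ R j 0

/-! ### Moments of irreducible conics and double lines, and bounds on the number of common zeros. -/

section Counting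

variable {F : Type*} [Field F] [Finite F]

/-- The finite set of forms of degree `d`. -/
noncomputable def formsFinset (F : Type*) [Field F] [Finite F] (d : ℕ) :
    Finset (MvPolynomial (Fin 3) F) := (finite_forms_set d).toFinset

theorem mem_formsFinset {d : ℕ} {g : MvPolynomial (Fin 3) F} :
    g ∈ formsFinset F d ↔ g ∈ forms F d := Set.Finite.mem_toFinset _

theorem card_formsFinset (d : ℕ) : (formsFinset F d).card = Nat.card F ^ (d + 2).choose 2 := by
  rw [← card_forms, formsFinset, ← Set.ncard_eq_toFinset_card _ (finite_forms_set d)]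
  rfl

open scoped Classical in
/-- The finite set of forms of degree `d` vanishing on `S`. -/
noncomputable def through (d : ℕ) (S : Finset (ℙ F (Fin 3 → F))) :
    Finset (MvPolynomial (Fin 3) F) := (formsFinset F d).filter fun g => ∀ p ∈ S, p ∈ zeros g

theorem mem_through {d : ℕ} {S : Finset (ℙ F (Fin 3 → F))} {g : MvPolynomial (Fin 3) F} :
    g ∈ through d S ↔ g ∈ forms F d ∧ ∀ p ∈ S, p ∈ zeros g := by
  classical
  rw [through, Finset.mem_filter, mem_formsFinset]

theorem card_through {d : ℕ} {S : Finset (ℙ F (Fin 3 → F))}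
    (hS : Separated d (S : Set (ℙ F (Fin 3 → F)))) (hcard : S.card ≤ (d + 2).choose 2) :
    (through d S).card = Nat.card F ^ ((d + 2).choose 2 - S.card) := by
  have h := hS.card_formsThrough
  have h2 : Nat.card (formsThrough d (S : Set (ℙ F (Fin 3 → F)))) = (through d S).card := by
    have : (formsThrough d (S : Set (ℙ F (Fin 3 → F))) : Set (MvPolynomial (Fin 3) F)) =
        (through d S : Finset (MvPolynomial (Fin 3) F)) := by
      ext g
      rw [Finset.mem_coe, mem_through]
      rfl
    rw [← Set.ncard_coe_finset, ← this]
    rfl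
  rw [card_forms, Set.ncard_coe_finset, h2] at h
  apply Nat.eq_of_mul_eq_mul_right (pow_pos (Nat.card_pos (α := F)) S.card)
  rw [h, ← pow_add, Nat.sub_add_cancel hcard]

open scoped Classical in
theorem card_filter_dvd {a b : ℕ} {f : MvPolynomial (Fin 3) F} (hf : f ∈ forms F a) (hf0 : f ≠ 0) :
    ((formsFinset F (a + b)).filter fun g => f ∣ g).card = Nat.card F ^ (b + 2).choose 2 := by
  rw [← card_formsFinset, ← Finset.card_image_of_injective (formsFinset F b) (mul_right_injective₀ hf0)]
  congr 1
  ext g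
  rw [Finset.mem_filter, Finset.mem_image, mem_formsFinset]
  constructor
  · rintro ⟨hg, h⟩
    obtain ⟨m, hm, rfl⟩ := (dvd_iff_exists_forms hf hg).1 h
    exact ⟨m, mem_formsFinset.2 hm, rfl⟩
  · rintro ⟨m, hm, rfl⟩
    exact ⟨mul_mem_forms hf (mem_formsFinset.1 hm), dvd_mul_right _ _⟩

-- Multiples of `f` vanish on `S` automatically, so the number to be discarded does not depend on
-- `S`.
open scoped Classical in
theorem card_through_filter_not_dvd {a b : ℕ} {f : MvPolynomial (Fin 3) F} (hf : f ∈ forms F a)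
    (hf0 : f ≠ 0) {S : Finset (ℙ F (Fin 3 → F))} (hS : ∀ p ∈ S, p ∈ zeros f) :
    ((through (a + b) S).filter fun g => ¬ f ∣ g).card + Nat.card F ^ (b + 2).choose 2 =
      (through (a + b) S).card := by
  rw [← card_filter_dvd (b := b) hf hf0,
    ← Finset.card_filter_add_card_filter_not (s := through (a + b) S) (fun g => f ∣ g), add_comm]
  congr 2
  ext g
  simp only [Finset.mem_filter, mem_through, mem_formsFinset]
  exact ⟨fun h => ⟨⟨h.1, fun p hp => zeros_subset_of_dvd h.2 (hS p hp)⟩, h.2⟩,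
    fun h => ⟨h.1.1, h.2⟩⟩

theorem linear_dvd_of_four {l g : MvPolynomial (Fin 3) F} (hl : l ∈ forms F 1)
    (hl0 : l ≠ 0) (hg : g ∈ forms F 3) {T : Finset (ℙ F (Fin 3 → F))} (hT : 4 ≤ T.card)
    (hTl : ∀ p ∈ T, p ∈ zeros l) (hTg : ∀ p ∈ T, p ∈ zeros g) : l ∣ g := by
  obtain ⟨T', hT', hc⟩ := Finset.exists_subset_card_eq hT
  obtain ⟨h, _, rfl⟩ := eq_mul_of_zeros_on_line (d := 2) hl hl0 T' hc (fun p hp => hTl p (hT' hp))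
    hg (fun p hp => hTg p (hT' hp))
  exact dvd_mul_right l h

open scoped Classical in
/-- The cubic forms without a common component with `f`. -/
noncomputable def partners (f : MvPolynomial (Fin 3) F) : Finset (MvPolynomial (Fin 3) F) :=
  (formsFinset F 3).filter fun g => ¬ ShareComponent (n := 2) f g

theorem mem_partners {f g : MvPolynomial (Fin 3) F} :
    g ∈ partners f ↔ g ∈ forms F 3 ∧ ¬ ShareComponent (n := 2) f g := by
  classical
  rw [partners, Finset.mem_filter, mem_formsFinset]

/-- The sum over the cubics `g` without a common component with `f` of the number of `j`-subsets
of the common zeros of `f` and `g`. -/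
noncomputable def moment (f : MvPolynomial (Fin 3) F) (j : ℕ) : ℕ :=
  ∑ g ∈ partners f, (zeros f ∩ zeros g).ncard.choose j

open scoped Classical in
theorem moment_eq_sum (f : MvPolynomial (Fin 3) F) (j : ℕ) :
    moment f j = ∑ S ∈ (Set.toFinite (zeros f)).toFinset.powersetCard j,
      ((partners f).filter fun g => ∀ p ∈ S, p ∈ zeros g).card := by
  rw [← sum_choose, moment]
  refine Finset.sum_congr rfl fun g _ => ?_
  rw [← Set.ncard_coe_finset]
  congr 2
  ext p
  simp

/-- Common treatment of the types in which sharing a component is divisibility by a single form `h`: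
the conic itself if irreducible, the underlying line if double. `b` is the degree of the cofactor.
-/
theorem moment_eq_of_dvd {a b : ℕ} (hab : a + b = 3) {f h : MvPolynomial (Fin 3) F}
    (hh : h ∈ forms F a) (hh0 : h ≠ 0) (hz : zeros f = zeros h)
    (hshare : ∀ g, ShareComponent (n := 2) f g ↔ h ∣ g) {j : ℕ} (hj : j ≤ 10)
    (hsep : ∀ S : Finset (ℙ F (Fin 3 → F)), (∀ p ∈ S, p ∈ zeros h) → S.card = j →
      Separated 3 (S : Set (ℙ F (Fin 3 → F)))) :
    (moment f j : ℚ) = (zeros f).ncard.choose j *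
      ((Nat.card F : ℚ) ^ (10 - j) - (Nat.card F : ℚ) ^ (b + 2).choose 2) := by
  classical
  rw [moment_eq_sum, Nat.cast_sum, Finset.sum_congr rfl (g := fun _ =>
    ((Nat.card F : ℚ) ^ (10 - j) - (Nat.card F : ℚ) ^ (b + 2).choose 2)), Finset.sum_const,
    Finset.card_powersetCard, ← Set.ncard_eq_toFinset_card, nsmul_eq_mul]
  intro S hS
  rw [Finset.mem_powersetCard] at hS
  have hSz : ∀ p ∈ S, p ∈ zeros h := fun p hp => by
    have := hS.1 hp
    rwa [Set.Finite.mem_toFinset, hz] at this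
  have h1 := card_through_filter_not_dvd (b := b) hh hh0 hSz
  rw [hab, card_through (hsep S hSz hS.2) (by rw [hS.2]; exact hj), hS.2,
    show Nat.choose (3 + 2) 2 = 10 from rfl] at h1
  rw [eq_sub_iff_add_eq]
  have h2 : ((partners f).filter fun g => ∀ p ∈ S, p ∈ zeros g) =
      (through 3 S).filter fun g => ¬ h ∣ g := by
    ext g
    simp only [Finset.mem_filter, mem_partners, mem_through, hshare]
    tauto
  rw [h2]
  exact_mod_cast h1

theorem moment_irreducible {f : MvPolynomial (Fin 3) F} (hf : f ∈ forms F 2)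
    (hirr : Irreducible f) {j : ℕ} (hj : j ≤ 7) :
    (moment f j : ℚ) = (zeros f).ncard.choose j *
      ((Nat.card F : ℚ) ^ (10 - j) - (Nat.card F : ℚ) ^ 3) :=
  moment_eq_of_dvd (a := 2) (b := 1) rfl hf hirr.ne_zero rfl (fun _ => shareComponent_iff_dvd hirr)
    (by omega) (fun S hS hc => separated_of_irreducible hf hirr S hS (by omega))

theorem moment_double {f l m : MvPolynomial (Fin 3) F} (hl : l ∈ forms F 1) (hm : m ∈ forms F 1)
    (hlm : Associated l m) (hl0 : l ≠ 0) (hf : f = l * m) {j : ℕ} (hj : j ≤ 4) :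
    (moment f j : ℚ) = (Nat.card F + 1).choose j *
      ((Nat.card F : ℚ) ^ (10 - j) - (Nat.card F : ℚ) ^ 6) := by
  have hz : zeros f = zeros l := by
    rw [hf, zeros_mul, Set.union_eq_left]
    exact zeros_subset_of_dvd hlm.symm.dvd
  rw [← ncard_zeros_linear hl hl0, ← hz]
  refine moment_eq_of_dvd (a := 1) (b := 2) rfl hl hl0 hz (fun g => ?_)
    (by omega) (fun S hS hc => separated_of_card_le S (by omega))
  rw [hf, shareComponent_mul_iff (irreducible_linear hl hl0)
    (irreducible_linear hm (hlm.ne_zero_iff.1 hl0)), hlm.symm.dvd_iff_dvd_left, or_self]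

theorem ncard_zeros_inter_le_three {l g : MvPolynomial (Fin 3) F} (hl : l ∈ forms F 1)
    (hl0 : l ≠ 0) (hg : g ∈ forms F 3) (h : ¬ l ∣ g) : (zeros l ∩ zeros g).ncard ≤ 3 := by
  classical
  by_contra! hc
  refine h (linear_dvd_of_four hl hl0 hg (T := (Set.toFinite (zeros l ∩ zeros g)).toFinset)
    (by rwa [← Set.ncard_eq_toFinset_card]) ?_ ?_)
  · intro p hp
    exact ((Set.Finite.mem_toFinset _).1 hp).1
  · intro p hp
    exact ((Set.Finite.mem_toFinset _).1 hp).2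

/-- Seven common zeros force an irreducible conic to divide `g`; a line not dividing `g` carries at
most three of its zeros. -/
theorem ncard_zeros_inter_le_six {f g : MvPolynomial (Fin 3) F} (hf : f ∈ forms F 2) (hf0 : f ≠ 0)
    (hg : g ∈ partners f) : (zeros f ∩ zeros g).ncard ≤ 6 := by
  classical
  rw [mem_partners] at hg
  rcases irreducible_or_eq_mul hf hf0 with hirr | ⟨l, hl, m, hm, rfl⟩
  · by_contra! hc
    rw [shareComponent_iff_dvd hirr] at hg
    rw [Set.ncard_eq_toFinset_card _ (Set.toFinite _)] at hc
    obtain ⟨S, hS, hS7⟩ := Finset.exists_subset_card_eq (Nat.succ_le_of_lt hc)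
    have hS' : ∀ a ∈ S, a ∈ zeros f ∩ zeros g := fun a ha => (Set.Finite.mem_toFinset _).1 (hS ha)
    exact hg.2 (dvd_of_irreducible_of_seven hf hirr hg.1 S (fun a ha => (hS' a ha).1)
      (fun a ha => (hS' a ha).2) hS7)
  · have hl0 := left_ne_zero_of_mul hf0
    have hm0 := right_ne_zero_of_mul hf0
    rw [shareComponent_mul_iff (irreducible_linear hl hl0) (irreducible_linear hm hm0), not_or] at hg
    rw [zeros_mul, Set.union_inter_distrib_right]
    have h1 := ncard_zeros_inter_le_three hl hl0 hg.1 hg.2.1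
    have h2 := ncard_zeros_inter_le_three hm hm0 hg.1 hg.2.2
    have h3 := Set.ncard_union_le (zeros l ∩ zeros g) (zeros m ∩ zeros g)
    omega

theorem moment_double_eq_zero {f l m : MvPolynomial (Fin 3) F} (hl : l ∈ forms F 1)
    (hm : m ∈ forms F 1) (hlm : Associated l m) (hl0 : l ≠ 0) (hf : f = l * m) {j : ℕ}
    (hj : 4 ≤ j) : moment f j = 0 := by
  refine Finset.sum_eq_zero fun g hg => Nat.choose_eq_zero_of_lt ?_
  rw [mem_partners, hf, shareComponent_mul_iff (irreducible_linear hl hl0)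
    (irreducible_linear hm (hlm.ne_zero_iff.1 hl0)), not_or] at hg
  have hz : zeros f = zeros l := by
    rw [hf, zeros_mul, Set.union_eq_left]
    exact zeros_subset_of_dvd hlm.symm.dvd
  rw [hz]
  have := ncard_zeros_inter_le_three hl hl0 hg.1 hg.2.1
  omega

end Counting

/-! ### Moments of a pair of distinct lines. -/

section TwoLines

variable {F : Type*} [Field F]

-- The cubic is a conic separating the three points of `S`, times `m`, which kills `P` and `T` but
-- not `p`.
open scoped Classical in
theorem exists_cubic_at_first_line {l m : MvPolynomial (Fin 3) F} (hm : m ∈ forms F 1)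
    {P : ℙ F (Fin 3 → F)} (hP : zeros l ∩ zeros m = {P}) {S T : Finset (ℙ F (Fin 3 → F))}
    (hS : ∀ p ∈ S, p ∈ zeros l \ {P}) (hT : ∀ p ∈ T, p ∈ zeros m \ {P}) (hS3 : S.card = 3)
    {p : ℙ F (Fin 3 → F)} (hp : p ∈ S) :
    ∃ g ∈ forms F 3, eval p.rep g ≠ 0 ∧
      ∀ a ∈ insert P (S ∪ T), a ≠ p → eval a.rep g = 0 := by
  obtain ⟨g, hg, h1, h2⟩ := separated_of_card_le (d := 2) S (by omega) p hp
  have hpm : p ∉ zeros m := fun h => (hS p hp).2 (hP ▸ ⟨(hS p hp).1, h⟩)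
  have hPm : P ∈ zeros m := (hP.symm ▸ Set.mem_singleton P : P ∈ zeros l ∩ zeros m).2
  refine ⟨g * m, mul_mem_forms hg hm, by rw [map_mul]; exact mul_ne_zero h1 hpm, fun a ha hap => ?_⟩
  rw [map_mul]
  rcases Finset.mem_insert.1 ha with rfl | ha
  · rw [mem_zeros.1 hPm, mul_zero]
  · rcases Finset.mem_union.1 ha with ha | ha
    · rw [h2 a ha hap, zero_mul]
    · rw [mem_zeros.1 (hT a ha).1, mul_zero]

variable [Finite F]

/-- The line through points on two different lines misses their intersection. -/
theorem exists_line_avoiding {l m : MvPolynomial (Fin 3) F} (hl : l ∈ forms F 1) (hl0 : l ≠ 0)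
    {P : ℙ F (Fin 3 → F)} (hP : zeros l ∩ zeros m = {P}) {a b : ℙ F (Fin 3 → F)}
    (ha : a ∈ zeros l) (haP : a ≠ P) (hb : b ∈ zeros m) (hbP : b ≠ P) :
    ∃ n ∈ forms F 1, eval P.rep n ≠ 0 ∧ eval a.rep n = 0 ∧ eval b.rep n = 0 := by
  classical
  have hPl : P ∈ zeros l := (hP.symm ▸ Set.mem_singleton P : P ∈ zeros l ∩ zeros m).1
  have hbl : b ∉ zeros l := fun h => hbP (Set.mem_singleton_iff.1 (hP ▸ ⟨h, hb⟩))
  have hab : a ≠ b := by rintro rfl; exact hbl ha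
  obtain ⟨n, hn, hn0, hna, hnb⟩ := exists_line_through hab
  refine ⟨n, hn, fun hnP => ?_, hna, hnb⟩
  obtain ⟨c, hc, rfl⟩ := eq_mul_of_zeros_on_line (d := 0) hl hl0 {a, P} (Finset.card_pair haP)
    (by simpa using ⟨ha, hPl⟩) hn (by simpa using ⟨hna, hnP⟩)
  rw [zeros_mul] at hnb
  rw [eq_zero_of_forms_zero hc (hnb.resolve_left hbl), mul_zero] at hn0
  exact hn0 rfl

-- A point off the intersection is handled by `exists_cubic_at_first_line`. For `P` itself, pair the
-- points of `S` with those of `T` and multiply the three joining lines, which all miss `P`.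
open scoped Classical in
theorem separated_two_lines {l m : MvPolynomial (Fin 3) F} (hl : l ∈ forms F 1) (hl0 : l ≠ 0)
    (hm : m ∈ forms F 1) {P : ℙ F (Fin 3 → F)} (hP : zeros l ∩ zeros m = {P})
    {S T : Finset (ℙ F (Fin 3 → F))} (hS : ∀ p ∈ S, p ∈ zeros l \ {P})
    (hT : ∀ p ∈ T, p ∈ zeros m \ {P}) (hS3 : S.card = 3) (hT3 : T.card = 3) :
    Separated 3 ((insert P (S ∪ T) : Finset (ℙ F (Fin 3 → F))) : Set (ℙ F (Fin 3 → F))) := by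
  intro p hp
  rcases Finset.mem_insert.1 (Finset.mem_coe.1 hp) with rfl | hp'
  · obtain ⟨a₁, a₂, a₃, -, -, -, rfl⟩ := Finset.card_eq_three.1 hS3
    obtain ⟨b₁, b₂, b₃, -, -, -, rfl⟩ := Finset.card_eq_three.1 hT3
    have key : ∀ a ∈ ({a₁, a₂, a₃} : Finset (ℙ F (Fin 3 → F))),
        ∀ b ∈ ({b₁, b₂, b₃} : Finset (ℙ F (Fin 3 → F))),
        ∃ n ∈ forms F 1, eval p.rep n ≠ 0 ∧ eval a.rep n = 0 ∧ eval b.rep n = 0 := fun a ha b hb =>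
      exists_line_avoiding hl hl0 hP (hS a ha).1 (hS a ha).2 (hT b hb).1 (hT b hb).2
    obtain ⟨n₁, h₁, h₁p, h₁a, h₁b⟩ := key a₁ (by simp) b₁ (by simp)
    obtain ⟨n₂, h₂, h₂p, h₂a, h₂b⟩ := key a₂ (by simp) b₂ (by simp)
    obtain ⟨n₃, h₃, h₃p, h₃a, h₃b⟩ := key a₃ (by simp) b₃ (by simp)
    refine ⟨n₁ * n₂ * n₃, mul_mem_forms (mul_mem_forms h₁ h₂) h₃, by simp [h₁p, h₂p, h₃p],
      fun a ha hap => ?_⟩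
    simp only [Finset.coe_insert, Finset.coe_union, Finset.coe_singleton, Set.mem_insert_iff,
      Set.mem_union, Set.mem_singleton_iff, hap, false_or] at ha
    rcases ha with (rfl | rfl | rfl) | (rfl | rfl | rfl) <;> simp [*]
  · rcases Finset.mem_union.1 hp' with hp' | hp'
    · exact exists_cubic_at_first_line hm hP hS hT hS3 hp'
    · rw [Set.inter_comm] at hP
      rw [Finset.union_comm]
      exact exists_cubic_at_first_line hl hP hT hS hT3 hp'

theorem linear_dvd_iff_of_four {l g : MvPolynomial (Fin 3) F} (hl : l ∈ forms F 1)
    (hl0 : l ≠ 0) (hg : g ∈ forms F 3) {T : Finset (ℙ F (Fin 3 → F))} (hT : T.card = 4)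
    (hTl : ∀ p ∈ T, p ∈ zeros l) : l ∣ g ↔ ∀ p ∈ T, p ∈ zeros g :=
  ⟨fun h p hp => zeros_subset_of_dvd h (hTl p hp), linear_dvd_of_four hl hl0 hg hT.ge hTl⟩

-- Inclusion–exclusion over divisibility by `l` and by `m`. `E` records whether `g` is required to
-- pass through `P`. Extending `S` and `T` to three points each, which needs `q ≥ 3`, turns every
-- condition into vanishing on a subset of one set of seven independent points.
open scoped Classical in
theorem card_partners_two_lines {l m : MvPolynomial (Fin 3) F} (hl : l ∈ forms F 1) (hl0 : l ≠ 0)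
    (hm : m ∈ forms F 1) (hm0 : m ≠ 0) {P : ℙ F (Fin 3 → F)} (hP : zeros l ∩ zeros m = {P})
    (hq : 3 ≤ Nat.card F) {S T E : Finset (ℙ F (Fin 3 → F))} (hS : ∀ p ∈ S, p ∈ zeros l \ {P})
    (hT : ∀ p ∈ T, p ∈ zeros m \ {P}) (hS3 : S.card ≤ 3) (hT3 : T.card ≤ 3) (hE : E ⊆ {P}) :
    (((partners (l * m)).filter fun g => ∀ p ∈ E, p ∈ zeros g).filter
        fun g => ∀ p ∈ S ∪ T, p ∈ zeros g).card +
      Nat.card F ^ (6 - S.card) + Nat.card F ^ (6 - T.card) =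
      Nat.card F ^ (10 - S.card - T.card - E.card) + Nat.card F ^ 3 := by
  have extend : ∀ (n : MvPolynomial (Fin 3) F) (_ : n ∈ forms F 1) (_ : n ≠ 0) (_ : P ∈ zeros n)
      (U : Finset (ℙ F (Fin 3 → F))), (∀ p ∈ U, p ∈ zeros n \ {P}) → U.card ≤ 3 →
      ∃ V : Finset (ℙ F (Fin 3 → F)), U ⊆ V ∧ V.card = 3 ∧ ∀ p ∈ V, p ∈ zeros n \ {P} := by
    intro n hn hn0 hPn U hU hU3
    have hc : (Set.toFinite (zeros n \ {P})).toFinset.card = Nat.card F := by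
      rw [← Set.ncard_eq_toFinset_card, Set.ncard_sdiff_singleton_of_mem hPn,
        ncard_zeros_linear hn hn0, Nat.add_sub_cancel]
    obtain ⟨V, hUV, hV, hV3⟩ := Finset.exists_subsuperset_card_eq
      (show U ⊆ (Set.toFinite (zeros n \ {P})).toFinset from fun p hp =>
        (Set.Finite.mem_toFinset _).2 (hU p hp)) hU3 (by rw [hc]; exact hq)
    exact ⟨V, hUV, hV3, fun p hp => (Set.Finite.mem_toFinset _).1 (hV hp)⟩
  have hPlm : P ∈ zeros l ∩ zeros m := hP.symm ▸ Set.mem_singleton P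
  obtain ⟨S', hSS', hS'3, hS'⟩ := extend l hl hl0 hPlm.1 S hS hS3
  obtain ⟨T', hTT', hT'3, hT'⟩ := extend m hm hm0 hPlm.2 T hT hT3
  have hsep := separated_two_lines hl hl0 hm hP hS' hT' hS'3 hT'3
  have hPS' : P ∉ S' := fun h => (hS' P h).2 rfl
  have hPT' : P ∉ T' := fun h => (hT' P h).2 rfl
  have hdisj : Disjoint S' T' := Finset.disjoint_left.2 fun p h1 h2 => (hS' p h1).2
    (hP ▸ ⟨(hS' p h1).1, (hT' p h2).1⟩)
  have count : ∀ (A B C : Finset (ℙ F (Fin 3 → F))), A ⊆ S' → B ⊆ T' → C ⊆ {P} →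
      (through 3 (C ∪ (A ∪ B))).card = Nat.card F ^ (10 - A.card - B.card - C.card) := by
    intro A B C hA hB hC
    have hcard : (C ∪ (A ∪ B)).card = C.card + (A.card + B.card) := by
      rw [Finset.card_union_of_disjoint, Finset.card_union_of_disjoint (hdisj.mono hA hB)]
      refine Finset.disjoint_left.2 fun p h1 h2 => ?_
      rw [Finset.mem_singleton.1 (hC h1)] at h2
      rcases Finset.mem_union.1 h2 with h | h
      exacts [hPS' (hA h), hPT' (hB h)]
    have hA3 := Finset.card_le_card hA
    have hB3 := Finset.card_le_card hB
    have hC1 := Finset.card_le_card hC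
    rw [Finset.card_singleton] at hC1
    have hsub : C ∪ (A ∪ B) ⊆ insert P (S' ∪ T') := by
      rw [Finset.insert_eq]
      exact Finset.union_subset_union hC (Finset.union_subset_union hA hB)
    rw [card_through (hsep.mono (Finset.coe_subset.2 hsub))
      (by rw [hcard, show Nat.choose (3 + 2) 2 = 10 from rfl]; omega), hcard,
      show Nat.choose (3 + 2) 2 = 10 from rfl]
    congr 1
    omega
  -- A cubic is divisible by a line exactly when it vanishes at four given points of it, here `P`
  -- and the three points of the extended set.
  have hdl : ∀ g ∈ forms F 3, l ∣ g ↔ ∀ p ∈ insert P S', p ∈ zeros g := fun g hg =>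
    linear_dvd_iff_of_four hl hl0 hg (by rw [Finset.card_insert_of_notMem hPS', hS'3])
      (by
        intro p hp
        rcases Finset.mem_insert.1 hp with rfl | hp
        exacts [hPlm.1, (hS' p hp).1])
  have hdm : ∀ g ∈ forms F 3, m ∣ g ↔ ∀ p ∈ insert P T', p ∈ zeros g := fun g hg =>
    linear_dvd_iff_of_four hm hm0 hg (by rw [Finset.card_insert_of_notMem hPT', hT'3])
      (by
        intro p hp
        rcases Finset.mem_insert.1 hp with rfl | hp
        exacts [hPlm.2, (hT' p hp).1])
  have hX := count S T E hSS' hTT' hE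
  have hY := count S' T {P} subset_rfl hTT' subset_rfl
  have hZ := count S T' {P} hSS' subset_rfl subset_rfl
  have hW := count S' T' {P} subset_rfl subset_rfl subset_rfl
  rw [hS'3, Finset.card_singleton, show 10 - 3 - T.card - 1 = 6 - T.card by omega] at hY
  rw [hT'3, Finset.card_singleton, show 10 - S.card - 3 - 1 = 6 - S.card by omega] at hZ
  rw [hS'3, hT'3, Finset.card_singleton, show 10 - 3 - 3 - 1 = 3 from rfl] at hW
  rw [← hX, ← hY, ← hZ, ← hW]
  have hfil : (((partners (l * m)).filter fun g => ∀ p ∈ E, p ∈ zeros g).filter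
      fun g => ∀ p ∈ S ∪ T, p ∈ zeros g) =
      through 3 (E ∪ (S ∪ T)) \ (through 3 ({P} ∪ (S' ∪ T)) ∪ through 3 ({P} ∪ (S ∪ T'))) := by
    ext g
    simp only [Finset.mem_filter, mem_partners, Finset.mem_sdiff, Finset.mem_union, mem_through]
    by_cases hg : g ∈ forms F 3
    · rw [shareComponent_mul_iff (irreducible_linear hl hl0) (irreducible_linear hm hm0),
        hdl g hg, hdm g hg]
      simp only [hg, true_and, Finset.mem_insert, Finset.mem_singleton, or_imp, forall_and,
        forall_eq]
      have h1 : (∀ x ∈ S', x ∈ zeros g) → ∀ x ∈ S, x ∈ zeros g := fun h x hx => h x (hSS' hx)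
      have h2 : (∀ x ∈ T', x ∈ zeros g) → ∀ x ∈ T, x ∈ zeros g := fun h x hx => h x (hTT' hx)
      tauto
    · simp [hg]
  have hsub : through 3 ({P} ∪ (S' ∪ T)) ∪ through 3 ({P} ∪ (S ∪ T')) ⊆
      through 3 (E ∪ (S ∪ T)) := by
    intro g
    simp only [Finset.mem_union, mem_through]
    have hE' : ∀ x ∈ E, x = P := fun x hx => Finset.mem_singleton.1 (hE hx)
    rintro (⟨h1, h2⟩ | ⟨h1, h2⟩) <;> refine ⟨h1, fun p hp => h2 p ?_⟩ <;>
      rcases hp with hp | hp | hp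
    · exact Or.inl (hE hp)
    · exact Or.inr (Or.inl (hSS' hp))
    · exact Or.inr (Or.inr hp)
    · exact Or.inl (hE hp)
    · exact Or.inr (Or.inl hp)
    · exact Or.inr (Or.inr (hTT' hp))
  have hint : through 3 ({P} ∪ (S' ∪ T)) ∩ through 3 ({P} ∪ (S ∪ T')) =
      through 3 ({P} ∪ (S' ∪ T')) := by
    ext g
    simp only [Finset.mem_inter, mem_through, Finset.mem_union, or_imp, forall_and]
    have h1 : (∀ x ∈ S', x ∈ zeros g) → ∀ x ∈ S, x ∈ zeros g := fun h x hx => h x (hSS' hx)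
    have h2 : (∀ x ∈ T', x ∈ zeros g) → ∀ x ∈ T, x ∈ zeros g := fun h x hx => h x (hTT' hx)
    tauto
  have h1 := Finset.card_sdiff_add_card_eq_card hsub
  have h2 := Finset.card_union_add_card_inter (through 3 ({P} ∪ (S' ∪ T)))
    (through 3 ({P} ∪ (S ∪ T')))
  rw [hint] at h2
  rw [hfil]
  omega

open scoped Classical in
theorem sum_choose_two_lines {l m : MvPolynomial (Fin 3) F} (hl : l ∈ forms F 1) (hl0 : l ≠ 0)
    (hm : m ∈ forms F 1) (hm0 : m ≠ 0) {P : ℙ F (Fin 3 → F)} (hP : zeros l ∩ zeros m = {P})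
    (hq : 3 ≤ Nat.card F) {E : Finset (ℙ F (Fin 3 → F))} (hE : E ⊆ {P}) {i k : ℕ} (hi : i ≤ 3)
    (hk : k ≤ 3) :
    ((∑ g ∈ (partners (l * m)).filter fun g => ∀ p ∈ E, p ∈ zeros g,
      ((zeros l ∩ zeros g) \ {P}).ncard.choose i * ((zeros m ∩ zeros g) \ {P}).ncard.choose k : ℕ)
        : ℚ) = (Nat.card F).choose i * (Nat.card F).choose k *
        ((Nat.card F : ℚ) ^ (10 - i - k - E.card) - (Nat.card F : ℚ) ^ (6 - i) -
          (Nat.card F : ℚ) ^ (6 - k) + (Nat.card F : ℚ) ^ 3) := by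
  have hPlm : P ∈ zeros l ∩ zeros m := hP.symm ▸ Set.mem_singleton P
  have hfin : ∀ (n g : MvPolynomial (Fin 3) F), ((zeros n ∩ zeros g) \ {P}).ncard =
      ((Set.toFinite (zeros n \ {P})).toFinset.filter fun p => p ∈ zeros g).card := by
    intro n g
    rw [← Set.ncard_coe_finset]
    congr 1
    ext p
    simp only [Set.mem_sdiff, Set.mem_inter_iff, Finset.coe_filter, Set.Finite.mem_toFinset,
      Set.mem_ofPred_eq]
    tauto
  have hc : ∀ n ∈ forms F 1, n ≠ 0 → P ∈ zeros n →
      (Set.toFinite (zeros n \ {P})).toFinset.card = Nat.card F := by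
    intro n hn hn0 hPn
    rw [← Set.ncard_eq_toFinset_card, Set.ncard_sdiff_singleton_of_mem hPn,
      ncard_zeros_linear hn hn0, Nat.add_sub_cancel]
  simp only [hfin]
  rw [sum_choose_mul_choose _ _ _ (fun g p => p ∈ zeros g), Nat.cast_sum,
    Finset.sum_congr rfl (g := fun _ => ((Nat.card F).choose k : ℚ) *
        ((Nat.card F : ℚ) ^ (10 - i - k - E.card) - (Nat.card F : ℚ) ^ (6 - i) -
          (Nat.card F : ℚ) ^ (6 - k) + (Nat.card F : ℚ) ^ 3)), Finset.sum_const,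
    Finset.card_powersetCard, hc l hl hl0 hPlm.1, nsmul_eq_mul, mul_assoc]
  intro S hS
  rw [Nat.cast_sum, Finset.sum_congr rfl (g := fun _ =>
        ((Nat.card F : ℚ) ^ (10 - i - k - E.card) - (Nat.card F : ℚ) ^ (6 - i) -
          (Nat.card F : ℚ) ^ (6 - k) + (Nat.card F : ℚ) ^ 3)), Finset.sum_const,
    Finset.card_powersetCard, hc m hm hm0 hPlm.2, nsmul_eq_mul]
  intro T hT
  rw [Finset.mem_powersetCard] at hS hT
  have h := card_partners_two_lines hl hl0 hm hm0 hP hq (S := S) (T := T) (E := E)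
    (fun p hp => (Set.Finite.mem_toFinset _).1 (hS.1 hp))
    (fun p hp => (Set.Finite.mem_toFinset _).1 (hT.1 hp)) (by omega) (by omega) hE
  rw [hS.2, hT.2] at h
  have h' := congrArg (Nat.cast (R := ℚ)) h
  push_cast at h'
  linear_combination h'

open scoped Classical in
theorem sum_choose_two_lines_eq_zero {l m : MvPolynomial (Fin 3) F} (hl : l ∈ forms F 1)
    (hl0 : l ≠ 0) (hm : m ∈ forms F 1) (hm0 : m ≠ 0) (P : ℙ F (Fin 3 → F))
    (E : Finset (ℙ F (Fin 3 → F))) {i k : ℕ} (hik : 3 < i ∨ 3 < k) :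
    ∑ g ∈ (partners (l * m)).filter fun g => ∀ p ∈ E, p ∈ zeros g,
      ((zeros l ∩ zeros g) \ {P}).ncard.choose i *
        ((zeros m ∩ zeros g) \ {P}).ncard.choose k = 0 := by
  refine Finset.sum_eq_zero fun g hg => ?_
  rw [Finset.mem_filter, mem_partners, shareComponent_mul_iff (irreducible_linear hl hl0)
    (irreducible_linear hm hm0), not_or] at hg
  obtain ⟨⟨hg, h1, h2⟩, -⟩ := hg
  have key : ∀ n ∈ forms F 1, n ≠ 0 → ¬ n ∣ g → ((zeros n ∩ zeros g) \ {P}).ncard ≤ 3 :=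
    fun n hn hn0 h => (Set.ncard_le_ncard Set.sdiff_subset).trans
      (ncard_zeros_inter_le_three hn hn0 hg h)
  have h3 := key l hl hl0 h1
  have h4 := key m hm hm0 h2
  rcases hik with h | h
  · rw [Nat.choose_eq_zero_of_lt (by omega), zero_mul]
  · rw [Nat.choose_eq_zero_of_lt (n := ((zeros m ∩ zeros g) \ {P}).ncard) (by omega), mul_zero]

/-- The number of ways to choose `i` and `k` points off the intersection on two lines, weighted by
the number of cubics containing neither line and passing through these points and `e` more. -/
noncomputable def twoLineTerm (q e i k : ℕ) : ℚ :=
  if i ≤ 3 ∧ k ≤ 3 then q.choose i * q.choose k *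
    ((q : ℚ) ^ (10 - i - k - e) - (q : ℚ) ^ (6 - i) - (q : ℚ) ^ (6 - k) + (q : ℚ) ^ 3) else 0

theorem ncard_zeros_mul_inter {l m : MvPolynomial (Fin 3) F} {P : ℙ F (Fin 3 → F)}
    (hP : zeros l ∩ zeros m = {P}) (g : MvPolynomial (Fin 3) F) [Decidable (P ∈ zeros g)] :
    (zeros (l * m) ∩ zeros g).ncard = ((zeros l ∩ zeros g) \ {P}).ncard +
      ((zeros m ∩ zeros g) \ {P}).ncard + if P ∈ zeros g then 1 else 0 := by
  have hPlm : P ∈ zeros l ∩ zeros m := hP.symm ▸ Set.mem_singleton P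
  have h1 : (zeros (l * m) ∩ zeros g) \ {P} =
      ((zeros l ∩ zeros g) \ {P}) ∪ ((zeros m ∩ zeros g) \ {P}) := by
    rw [zeros_mul, Set.union_inter_distrib_right, Set.union_sdiff_distrib]
  have h2 : Disjoint ((zeros l ∩ zeros g) \ {P}) ((zeros m ∩ zeros g) \ {P}) :=
    Set.disjoint_left.2 fun p hp hp' => hp.2 (hP ▸ ⟨hp.1.1, hp'.1.1⟩)
  rw [← Set.ncard_union_eq h2, ← h1]
  split_ifs with h
  · rw [Set.ncard_sdiff_singleton_add_one]
    exact ⟨by rw [zeros_mul]; exact Or.inl hPlm.1, h⟩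
  · rw [Set.sdiff_singleton_eq_self (fun h' => h h'.2), add_zero]

/-- The common zeros split into those on `l` off `P`, those on `m` off `P`, and possibly `P`.
Vandermonde's identity separates the two lines; Pascal's rule accounts for `P` and produces the sum
for `j - 1`. -/
theorem moment_two_lines {l m : MvPolynomial (Fin 3) F} (hl : l ∈ forms F 1) (hl0 : l ≠ 0)
    (hm : m ∈ forms F 1) (hm0 : m ≠ 0) {P : ℙ F (Fin 3 → F)} (hP : zeros l ∩ zeros m = {P})
    (hq : 3 ≤ Nat.card F) (j : ℕ) :
    (moment (l * m) j : ℚ) =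
      ∑ x ∈ Finset.HasAntidiagonal.antidiagonal j, twoLineTerm (Nat.card F) 0 x.1 x.2 +
        if j = 0 then 0 else
          ∑ x ∈ Finset.HasAntidiagonal.antidiagonal (j - 1), twoLineTerm (Nat.card F) 1 x.1 x.2 := by
  classical
  let H : Finset (ℙ F (Fin 3 → F)) → ℕ → ℕ → ℕ := fun E i k =>
    ∑ g ∈ (partners (l * m)).filter fun g => ∀ p ∈ E, p ∈ zeros g,
      ((zeros l ∩ zeros g) \ {P}).ncard.choose i * ((zeros m ∩ zeros g) \ {P}).ncard.choose k
  have hH : ∀ E ⊆ ({P} : Finset (ℙ F (Fin 3 → F))), ∀ i k,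
      (H E i k : ℚ) = twoLineTerm (Nat.card F) E.card i k := by
    intro E hE i k
    rw [twoLineTerm]
    split_ifs with h
    · exact sum_choose_two_lines hl hl0 hm hm0 hP hq hE h.1 h.2
    · exact_mod_cast sum_choose_two_lines_eq_zero hl hl0 hm hm0 P E (i := i) (k := k) (by omega)
  have hsum : moment (l * m) j = ∑ x ∈ Finset.HasAntidiagonal.antidiagonal j, H ∅ x.1 x.2 +
      if j = 0 then 0 else ∑ x ∈ Finset.HasAntidiagonal.antidiagonal (j - 1), H {P} x.1 x.2 := by
    have e1 : ∀ j, ∑ x ∈ Finset.HasAntidiagonal.antidiagonal j, H ∅ x.1 x.2 = ∑ g ∈ partners (l * m),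
        (((zeros l ∩ zeros g) \ {P}).ncard + ((zeros m ∩ zeros g) \ {P}).ncard).choose j := by
      intro j
      simp only [H, Finset.notMem_empty, false_imp_iff, implies_true, Finset.filter_true]
      rw [Finset.sum_comm]
      exact Finset.sum_congr rfl fun g _ => (Nat.add_choose_eq _ _ _).symm
    have e2 : ∀ j, ∑ x ∈ Finset.HasAntidiagonal.antidiagonal j, H {P} x.1 x.2 = ∑ g ∈ partners (l * m),
        if P ∈ zeros g then
          (((zeros l ∩ zeros g) \ {P}).ncard + ((zeros m ∩ zeros g) \ {P}).ncard).choose j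
        else 0 := by
      intro j
      simp only [H, Finset.mem_singleton, forall_eq]
      rw [Finset.sum_comm, Finset.sum_filter]
      refine Finset.sum_congr rfl fun g _ => ?_
      rw [Nat.add_choose_eq]
    rw [e1, e2, moment]
    cases j with
    | zero => simp
    | succ j =>
      rw [if_neg (Nat.succ_ne_zero j), Nat.add_sub_cancel, ← Finset.sum_add_distrib]
      refine Finset.sum_congr rfl fun g _ => ?_
      rw [ncard_zeros_mul_inter hP]
      split_ifs
      · rw [Nat.choose_succ_succ', add_comm]
      · rfl
  rw [hsum]
  push_cast
  congr 1
  · exact Finset.sum_congr rfl fun x _ => hH ∅ (by simp) _ _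
  · split_ifs
    · rfl
    · exact Finset.sum_congr rfl fun x _ => by rw [hH {P} subset_rfl, Finset.card_singleton]

end TwoLines

/-! ### The four types of conics and how many forms there are of each. -/

section Types

variable {F : Type*} [Field F]

open scoped Classical in
/-- The type of a nonzero quadratic form over a finite field: `0` for a pair of conjugate lines, `1`
for a smooth conic, `2` for a double line, `3` for two different lines. -/
noncomputable def conicType (f : MvPolynomial (Fin 3) F) : Fin 4 :=
  if Irreducible f then (if (zeros f).ncard = 1 then 0 else 1)
  else if ∃ l ∈ forms F 1, ∃ m ∈ forms F 1, Associated l m ∧ f = l * m then 2 else 3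

theorem isUnit_of_mem_forms_zero {c : MvPolynomial (Fin 3) F} (hc : c ∈ forms F 0) (h0 : c ≠ 0) :
    IsUnit c := by
  have h := totalDegree_eq_zero_iff_eq_C.1 ((totalDegree_zero_iff_isHomogeneous _).2 hc)
  rw [h] at h0 ⊢
  exact (isUnit_iff_ne_zero.2 fun h' => h0 (by rw [h', map_zero])).map C

theorem exists_eq_smul_of_associated {l m : MvPolynomial (Fin 3) F} (h : Associated l m) :
    ∃ r : F, r ≠ 0 ∧ m = r • l := by
  obtain ⟨u, rfl⟩ := h
  have h1 := (isUnit_iff_totalDegree_of_isReduced.1 u.isUnit)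
  have h2 := totalDegree_eq_zero_iff_eq_C.1 h1.2
  refine ⟨coeff 0 (u : MvPolynomial (Fin 3) F), h1.1.ne_zero, ?_⟩
  conv_lhs => rw [h2, mul_comm]
  rw [smul_eq_C_mul]

theorem conicType_mem_zero_one {f : MvPolynomial (Fin 3) F} (h : Irreducible f) :
    conicType f = if (zeros f).ncard = 1 then 0 else 1 := by
  rw [conicType, if_pos h]

theorem irreducible_of_conicType {f : MvPolynomial (Fin 3) F}
    (h : conicType f = 0 ∨ conicType f = 1) : Irreducible f := by
  rw [conicType] at h
  split_ifs at h with h1 h2 <;> first | exact h1 | simp at h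

theorem conicType_eq_two_iff {f : MvPolynomial (Fin 3) F} :
    conicType f = 2 ↔ ∃ l ∈ forms F 1, ∃ m ∈ forms F 1, Associated l m ∧ f = l * m := by
  constructor
  · intro h
    rw [conicType] at h
    split_ifs at h with h1 h2 h3
    · simp at h
    · simp at h
    · exact h3
    · simp at h
  · intro h
    have h1 : ¬ Irreducible f := by
      obtain ⟨l, hl, m, hm, -, rfl⟩ := h
      exact not_irreducible_mul one_ne_zero one_ne_zero hl hm
    rw [conicType, if_neg h1, if_pos h]

variable [Finite F]

theorem exists_zeros_inter_eq_singleton {l m : MvPolynomial (Fin 3) F} (hl : l ∈ forms F 1)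
    (hl0 : l ≠ 0) (hm : m ∈ forms F 1) (hm0 : m ≠ 0) (h : ¬ Associated l m) :
    ∃ P, zeros l ∩ zeros m = {P} := by
  classical
  obtain ⟨P, hP⟩ := exists_mem_zeros_inter hl hm
  refine ⟨P, Set.eq_singleton_iff_unique_mem.2 ⟨hP, fun x hx => ?_⟩⟩
  by_contra hxP
  obtain ⟨c, hc, rfl⟩ := eq_mul_of_zeros_on_line (d := 0) hl hl0 {x, P} (Finset.card_pair hxP)
    (by simpa using ⟨hx.1, hP.1⟩) hm (by simpa using ⟨hx.2, hP.2⟩)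
  exact h (associated_mul_unit_right l c
    (isUnit_of_mem_forms_zero hc (right_ne_zero_of_mul hm0)))

theorem ncard_zeros_two_lines {l m : MvPolynomial (Fin 3) F} (hl : l ∈ forms F 1)
    (hl0 : l ≠ 0) (hm : m ∈ forms F 1) (hm0 : m ≠ 0) {P : ℙ F (Fin 3 → F)}
    (hP : zeros l ∩ zeros m = {P}) : (zeros (l * m)).ncard = 2 * Nat.card F + 1 := by
  have h := Set.ncard_union_add_ncard_inter (zeros l) (zeros m)
  rw [hP, Set.ncard_singleton, ncard_zeros_linear hl hl0, ncard_zeros_linear hm hm0,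
    ← zeros_mul] at h
  omega

theorem exists_lines_of_conicType_eq_three {f : MvPolynomial (Fin 3) F} (hf : f ∈ forms F 2)
    (hf0 : f ≠ 0) (h : conicType f = 3) :
    ∃ l ∈ forms F 1, ∃ m ∈ forms F 1, l ≠ 0 ∧ m ≠ 0 ∧ f = l * m ∧
      ∃ P, zeros l ∩ zeros m = {P} := by
  rw [conicType] at h
  split_ifs at h with h1 h2 h3
  · simp at h
  · simp at h
  · simp at h
  obtain ⟨l, hl, m, hm, rfl⟩ := (irreducible_or_eq_mul hf hf0).resolve_left h1
  have hl0 := left_ne_zero_of_mul hf0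
  have hm0 := right_ne_zero_of_mul hf0
  exact ⟨l, hl, m, hm, hl0, hm0, rfl, exists_zeros_inter_eq_singleton hl hl0 hm hm0
    fun ha => h3 ⟨l, hl, m, hm, ha, rfl⟩⟩

/-- The number of points of a conic of given type. -/
def conicPoints (q : ℕ) : Fin 4 → ℕ := ![1, q + 1, q + 1, 2 * q + 1]

theorem ncard_zeros_eq_conicPoints {f : MvPolynomial (Fin 3) F} (hf : f ∈ forms F 2)
    (hf0 : f ≠ 0) : (zeros f).ncard = conicPoints (Nat.card F) (conicType f) := by
  by_cases hirr : Irreducible f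
  · rw [conicType_mem_zero_one hirr]
    split_ifs with h
    · exact h
    · exact (ncard_zeros_of_irreducible hf hirr).resolve_left h
  · by_cases h2 : conicType f = 2
    · rw [h2]
      obtain ⟨l, hl, m, hm, hlm, rfl⟩ := conicType_eq_two_iff.1 h2
      rw [zeros_mul, Set.union_eq_left.2 (zeros_subset_of_dvd hlm.symm.dvd)]
      exact ncard_zeros_linear hl (left_ne_zero_of_mul hf0)
    · have h3 : conicType f = 3 := by
        have h0 := fun h => hirr (irreducible_of_conicType h)
        generalize conicType f = c at *
        fin_cases c <;> simp_all
      rw [h3]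
      obtain ⟨l, hl, m, hm, hl0, hm0, rfl, P, hP⟩ := exists_lines_of_conicType_eq_three hf hf0 h3
      exact ncard_zeros_two_lines hl hl0 hm hm0 hP

/-- The moment of a conic of given type. -/
noncomputable def typeMoment (q j : ℕ) : Fin 4 → ℚ :=
  ![(1 : ℕ).choose j * ((q : ℚ) ^ (10 - j) - (q : ℚ) ^ 3),
    (q + 1).choose j * ((q : ℚ) ^ (10 - j) - (q : ℚ) ^ 3),
    if j ≤ 4 then (q + 1).choose j * ((q : ℚ) ^ (10 - j) - (q : ℚ) ^ 6) else 0,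
    ∑ x ∈ Finset.HasAntidiagonal.antidiagonal j, twoLineTerm q 0 x.1 x.2 +
        if j = 0 then 0 else
          ∑ x ∈ Finset.HasAntidiagonal.antidiagonal (j - 1), twoLineTerm q 1 x.1 x.2]

theorem moment_eq_typeMoment (hq : 3 ≤ Nat.card F) {f : MvPolynomial (Fin 3) F}
    (hf : f ∈ forms F 2) (hf0 : f ≠ 0) {j : ℕ} (hj : j ≤ 7) :
    (moment f j : ℚ) = typeMoment (Nat.card F) j (conicType f) := by
  have hz := ncard_zeros_eq_conicPoints hf hf0
  by_cases h0 : conicType f = 0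
  · rw [moment_irreducible hf (irreducible_of_conicType (Or.inl h0)) hj, hz, h0]
    rfl
  by_cases h1 : conicType f = 1
  · rw [moment_irreducible hf (irreducible_of_conicType (Or.inr h1)) hj, hz, h1]
    rfl
  by_cases h2 : conicType f = 2
  · obtain ⟨l, hl, m, hm, hlm, rfl⟩ := conicType_eq_two_iff.1 h2
    have hl0 := left_ne_zero_of_mul hf0
    rw [h2]
    change _ = if j ≤ 4 then _ else _
    split_ifs with h4
    · exact moment_double hl hm hlm hl0 rfl h4
    · exact_mod_cast moment_double_eq_zero hl hm hlm hl0 rfl (by omega)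
  · have h3 : conicType f = 3 := by
      generalize conicType f = c at *
      fin_cases c <;> simp_all
    rw [h3]
    obtain ⟨l, hl, m, hm, hl0, hm0, rfl, P, hP⟩ := exists_lines_of_conicType_eq_three hf hf0 h3
    exact moment_two_lines hl hl0 hm hm0 hP hq j

open scoped Classical in
/-- The number of quadratic forms of type `c`. -/
noncomputable def typeCount (F : Type*) [Field F] [Finite F] (c : Fin 4) : ℕ :=
  (((formsFinset F 2).erase 0).filter fun f => conicType f = c).card

open scoped Classical in
theorem sum_conicType (φ : Fin 4 → ℚ) :
    ∑ f ∈ (formsFinset F 2).erase 0, φ (conicType f) = ∑ c, typeCount F c * φ c := by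
  classical
  rw [← Finset.sum_fiberwise ((formsFinset F 2).erase 0) conicType]
  refine Finset.sum_congr rfl fun c _ => ?_
  rw [Finset.sum_congr rfl (g := fun _ => φ c), Finset.sum_const, nsmul_eq_mul, typeCount]
  intro f hf
  rw [(Finset.mem_filter.1 hf).2]

theorem card_points : Nat.card (ℙ F (Fin 3 → F)) = Nat.card F ^ 2 + Nat.card F + 1 := by
  rw [Projectivization.card_of_finrank F (Fin 3 → F) (n := 3) (by simp)]
  simp [Finset.sum_range_succ]
  ring

/-- Double count of conics and `j`-subsets of their zeros. Up to three points are independent for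
conics; the `- 1` removes the zero form, which vanishes on every subset. -/
theorem sum_choose_conicPoints {j : ℕ} (hj : j ≤ 3) :
    ∑ c, (typeCount F c : ℚ) * (conicPoints (Nat.card F) c).choose j =
      (Nat.card F ^ 2 + Nat.card F + 1).choose j * ((Nat.card F : ℚ) ^ (6 - j) - 1) := by
  classical
  have := Fintype.ofFinite (ℙ F (Fin 3 → F))
  have h1 := sum_choose (formsFinset F 2) Finset.univ (fun g p => p ∈ zeros g) j
  have h2 : ∀ g : MvPolynomial (Fin 3) F,
      (Finset.univ.filter fun p => p ∈ zeros g).card = (zeros g).ncard := fun g => by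
    rw [← Set.ncard_coe_finset]
    congr 1
    ext p
    simp
  simp only [h2] at h1
  rw [Finset.sum_congr (s₁ := Finset.univ.powersetCard j) rfl
      (g := fun _ => Nat.card F ^ (6 - j)), Finset.sum_const,
    Finset.card_powersetCard, Finset.card_univ, ← Nat.card_eq_fintype_card, card_points,
    smul_eq_mul, ← Finset.add_sum_erase _ _ (mem_formsFinset.2 (zero_mem _))] at h1
  · have h3 : (zeros (0 : MvPolynomial (Fin 3) F)).ncard = Nat.card F ^ 2 + Nat.card F + 1 := by
      rw [← card_points, ← Set.ncard_univ]
      congr 1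
      ext p
      simp [mem_zeros]
    rw [h3, Finset.sum_congr rfl (g := fun f =>
      (conicPoints (Nat.card F) (conicType f)).choose j)] at h1
    · rw [← sum_conicType (fun c => ((conicPoints (Nat.card F) c).choose j : ℚ))]
      have h4 := congrArg (Nat.cast (R := ℚ)) h1
      push_cast at h4 ⊢
      linear_combination h4
    · intro f hf
      rw [Finset.mem_erase, mem_formsFinset] at hf
      rw [ncard_zeros_eq_conicPoints hf.2 hf.1]
  · intro S hS
    have hS := (Finset.mem_powersetCard.1 hS).2
    have := card_through (d := 2) (separated_of_card_le S (by omega))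
      (by rw [hS, show Nat.choose (2 + 2) 2 = 6 from rfl]; omega)
    rw [hS, show Nat.choose (2 + 2) 2 = 6 from rfl] at this
    rw [← this, through]

/-- By unique factorisation a double line is a unit scalar times the square of a chosen
representative of a point of the dual plane, both uniquely determined. -/
theorem typeCount_two : typeCount F 2 = Nat.card F ^ 3 - 1 := by
  classical
  have hne : ∀ p : ℙ F (forms F 1), (p.rep : MvPolynomial (Fin 3) F) ≠ 0 := fun p h =>
    p.rep_nonzero (Subtype.ext h)
  have hcard : Nat.card (ℙ F (forms F 1) × Fˣ) = Nat.card F ^ 3 - 1 := by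
    rw [Nat.card_prod, Nat.card_units, ← Projectivization.card, card_forms]
    rfl
  rw [typeCount, ← hcard, ← Set.ncard_coe_finset, ← Nat.card_coe_set_eq]
  symm
  refine Nat.card_congr (Equiv.ofBijective (fun x => ⟨(x.2 : F) • (x.1.rep.1 * x.1.rep.1), ?_⟩)
    ⟨?_, ?_⟩)
  · have h1 := smul_ne_zero x.2.ne_zero (mul_ne_zero (hne x.1) (hne x.1))
    rw [Finset.mem_coe, Finset.mem_filter, Finset.mem_erase, mem_formsFinset, conicType_eq_two_iff]
    refine ⟨⟨h1, Submodule.smul_mem _ _ (mul_mem_forms x.1.rep.2 x.1.rep.2)⟩, x.1.rep.1,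
      x.1.rep.2, (x.2 : F) • x.1.rep.1, Submodule.smul_mem _ _ x.1.rep.2, ?_, ?_⟩
    · rw [smul_eq_C_mul]
      exact associated_unit_mul_right _ _ (x.2.isUnit.map C)
    · rw [mul_smul_comm]
  · rintro ⟨p, a⟩ ⟨p', b⟩ h
    have h1 : (a : F) • (p.rep.1 * p.rep.1) = (b : F) • (p'.rep.1 * p'.rep.1) :=
      congrArg Subtype.val h
    have hi := irreducible_linear p.rep.2 (hne p)
    have hi' := irreducible_linear p'.rep.2 (hne p')
    have hd : p.rep.1 ∣ p'.rep.1 * p'.rep.1 := by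
      refine ⟨((b : F)⁻¹ * a) • p.rep.1, ?_⟩
      rw [mul_smul_comm, mul_smul, h1, smul_smul, inv_mul_cancel₀ b.ne_zero, one_smul]
    have hd' := (or_self_iff.1 (hi.prime.dvd_or_dvd hd))
    obtain ⟨r, hr, he⟩ := exists_eq_smul_of_associated (hi.associated_of_dvd hi' hd')
    have hp : p = p' := by
      rw [← p.mk_rep, ← p'.mk_rep, eq_comm, Projectivization.mk_eq_mk_iff']
      exact ⟨r, Subtype.ext he.symm⟩
    subst hp
    have := smul_left_injective F (mul_ne_zero (hne p) (hne p)) h1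
    rw [Units.ext this]
  · rintro ⟨f, hf⟩
    rw [Finset.mem_coe, Finset.mem_filter, Finset.mem_erase, conicType_eq_two_iff] at hf
    obtain ⟨⟨hf0, -⟩, l, hl, m, -, hlm, rfl⟩ := hf
    obtain ⟨r, hr, rfl⟩ := exists_eq_smul_of_associated hlm
    have hl0 : (⟨l, hl⟩ : forms F 1) ≠ 0 := fun h =>
      left_ne_zero_of_mul hf0 (congrArg Subtype.val h)
    obtain ⟨a, ha⟩ := Projectivization.exists_smul_eq_mk_rep F _ hl0
    -- The chosen representative is `a • l`, so its square must be scaled by r a⁻² to give r l².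
    refine ⟨⟨Projectivization.mk F _ hl0, Units.mk0 r hr * a⁻¹ * a⁻¹⟩, Subtype.ext ?_⟩
    simp only [← ha]
    simp only [Units.smul_def, Submodule.coe_smul, Units.val_mul, Units.val_mk0, mul_smul_comm,
      smul_mul_assoc, smul_smul]
    congr 1
    have := a.ne_zero
    push_cast
    field_simp

end Types

/-! ### Binomial moments of the numbers c_k. -/

section Numbers

variable {F : Type*} [Field F]

/-- Ensures that `partners f` never contains the zero cubic, so nonvanishing of `g` need not be
imposed separately. -/
theorem shareComponent_zero {f : MvPolynomial (Fin 3) F} (hf : ¬ IsUnit f) (hf0 : f ≠ 0) :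
    ShareComponent (n := 2) f 0 := by
  obtain ⟨p, hp, hpf⟩ := WfDvdMonoid.exists_irreducible_factor hf hf0
  obtain ⟨h, hh, h1, h2⟩ := (shareComponent_iff_dvd hp).2 (dvd_zero p)
  exact ⟨h, hh, h1.trans (map_dvd (map (algebraMap F (AlgebraicClosure F))) hpf), h2⟩

variable [Finite F]

open scoped Classical in
theorem numPairs_eq_sum (k : ℕ) :
    numPairs F k = ∑ f ∈ (formsFinset F 2).erase 0,
      ((partners f).filter fun g => (zeros f ∩ zeros g).ncard = k).card := by
  rw [← Finset.card_sigma, ← Set.ncard_coe_finset, numPairs]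
  refine Set.ncard_congr (fun x _ => ⟨x.1, x.2⟩) ?_ ?_ ?_
  · rintro ⟨f, g⟩ ⟨⟨hf, hf0, hg, hg0⟩, hs, hk⟩
    simp only [Finset.mem_coe, Finset.mem_sigma, Finset.mem_erase, mem_formsFinset,
      Finset.mem_filter, mem_partners]
    exact ⟨⟨hf0, hf⟩, ⟨hg, hs⟩, hk⟩
  · rintro ⟨f, g⟩ ⟨f', g'⟩ _ _ h
    simpa using h
  · rintro ⟨f, g⟩ h
    simp only [Finset.mem_coe, Finset.mem_sigma, Finset.mem_erase, mem_formsFinset,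
      Finset.mem_filter, mem_partners] at h
    obtain ⟨⟨hf0, hf⟩, ⟨hg, hs⟩, hk⟩ := h
    refine ⟨(f, g), ⟨⟨hf, hf0, hg, ?_⟩, hs, hk⟩, rfl⟩
    rintro rfl
    exact hs (shareComponent_zero (not_isUnit_of_mem_forms two_ne_zero hf) hf0)

/-- The total moment over all nonzero conics, grouped by the number of common zeros on the left and
by the type of the conic on the right. -/
theorem sum_choose_mul_numPairs (hq : 3 ≤ Nat.card F) {j : ℕ} (hj : j ≤ 7) :
    ∑ k ∈ Finset.range 7, (k.choose j : ℚ) * numPairs F k =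
      ∑ c, typeCount F c * typeMoment (Nat.card F) j c := by
  classical
  rw [← sum_conicType]
  simp only [numPairs_eq_sum, Nat.cast_sum, Finset.mul_sum]
  rw [Finset.sum_comm]
  refine Finset.sum_congr rfl fun f hf => ?_
  rw [Finset.mem_erase, mem_formsFinset] at hf
  rw [← moment_eq_typeMoment hq hf.2 hf.1 hj, moment, ← Finset.sum_fiberwise_of_maps_to
    (t := Finset.range 7) (g := fun g => (zeros f ∩ zeros g).ncard), Nat.cast_sum]
  · refine Finset.sum_congr rfl fun k _ => ?_
    rw [Finset.sum_congr rfl (g := fun _ => k.choose j), Finset.sum_const, smul_eq_mul,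
      Nat.cast_mul, mul_comm]
    intro g hg
    rw [(Finset.mem_filter.1 hg).2]
  · intro g hg
    rw [Finset.mem_range]
    have := ncard_zeros_inter_le_six hf.2 hf.1 hg
    omega

end Numbers

/-! ### Solving for the closed formulas. -/

section Formulas

/-- Rewrites binomials in `q` as polynomials; it stays valid for `k ≥ n`, where both sides vanish.
-/
theorem cast_choose_succ (n k : ℕ) :
    (n.choose (k + 1) : ℚ) = n.choose k * ((n : ℚ) - k) / (k + 1) := by
  have h := Nat.choose_succ_right_eq n k
  rw [eq_div_iff (by positivity)]
  rcases le_or_gt k n with hk | hk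
  · rw [← Nat.cast_sub hk]
    exact_mod_cast h
  · rw [Nat.choose_eq_zero_of_lt hk, Nat.choose_eq_zero_of_lt (by omega)]
    simp

variable {F : Type*} [Field F] [Finite F]

theorem typeCount_values {q : ℕ} (hF : Nat.card F = q) (hq : 0 < q) :
    (typeCount F 0 : ℚ) = ((q : ℚ) - 1) * ((q : ℚ) ^ 2 + q + 1) * ((q : ℚ) ^ 2 - q) / 2 ∧
    (typeCount F 1 : ℚ) = ((q : ℚ) - 1) * ((q : ℚ) ^ 5 - (q : ℚ) ^ 2) ∧
    (typeCount F 2 : ℚ) = (q : ℚ) ^ 3 - 1 ∧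
    (typeCount F 3 : ℚ) = ((q : ℚ) - 1) * ((q : ℚ) ^ 2 + q + 1) * ((q : ℚ) ^ 2 + q) / 2 := by
  have h0 := sum_choose_conicPoints (F := F) (j := 0) (by norm_num)
  have h1 := sum_choose_conicPoints (F := F) (j := 1) (by norm_num)
  have h2 := sum_choose_conicPoints (F := F) (j := 2) (by norm_num)
  have h3 : (typeCount F 2 : ℚ) = (q : ℚ) ^ 3 - 1 := by
    rw [typeCount_two, hF, Nat.cast_sub (Nat.one_le_pow _ _ hq)]
    simp
  have hq0 : (q : ℚ) ≠ 0 := by exact_mod_cast hq.ne'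
  simp only [hF, Fin.sum_univ_four, conicPoints, Nat.choose_zero_right, cast_choose_succ,
    Nat.choose_one_right, Matrix.cons_val] at h0 h1 h2
  push_cast at h0 h1 h2
  have h4 : (typeCount F 3 : ℚ) =
      ((q : ℚ) - 1) * ((q : ℚ) ^ 2 + q + 1) * ((q : ℚ) ^ 2 + q) / 2 := by
    apply mul_left_cancel₀ (pow_ne_zero 2 hq0)
    -- With N points, C(N, 2) - (q+1)(N-1)/2 is 0 for N = 1 and N = q + 1, and q² for N = 2q + 1, so
    -- only the pairs of lines remain.
    linear_combination h2 - (q + 1) / 2 * (h1 - h0)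
  have h5 : (typeCount F 1 : ℚ) = ((q : ℚ) - 1) * ((q : ℚ) ^ 5 - (q : ℚ) ^ 2) := by
    apply mul_left_cancel₀ hq0
    linear_combination h1 - h0 - q * h3 - 2 * q * h4
  exact ⟨by linear_combination h0 - h5 - h3 - h4, h5, h3, h4⟩

theorem numPairs_values {q : ℕ} (hF : Nat.card F = q) (hq : 2 < q) :
    (numPairs F 0 : ℚ) =
      53 / 144 * ((q : ℚ) - 1) ^ 3 * (q : ℚ) ^ 6 * ((q : ℚ) ^ 2 + q + 1) *
        ((q : ℚ) ^ 5 + (q : ℚ) ^ 4 + 9 / 53 * (q : ℚ) ^ 3 + 27 / 53 * (q : ℚ) ^ 2 +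
          58 / 53 * q - 32 / 53) ∧
    (numPairs F 1 : ℚ) =
      11 / 30 * (q : ℚ) ^ 4 * ((q : ℚ) - 1) ^ 2 * ((q : ℚ) ^ 2 + q + 1) * ((q : ℚ) + 1) *
        ((q : ℚ) ^ 7 + 1 / 44 * (q : ℚ) ^ 6 + 5 / 11 * (q : ℚ) ^ 5 + 20 / 11 * (q : ℚ) ^ 4 -
          31 / 11 * (q : ℚ) ^ 3 + 159 / 44 * (q : ℚ) ^ 2 + 15 / 11 * q - 30 / 11) ∧
    (numPairs F 2 : ℚ) =
      3 / 16 * ((q : ℚ) - 1) ^ 2 * ((q : ℚ) + 1) ^ 2 * (q : ℚ) ^ 5 * ((q : ℚ) ^ 2 + q + 1) *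
        ((q : ℚ) ^ 5 - 2 / 9 * (q : ℚ) ^ 4 + 35 / 9 * (q : ℚ) ^ 3 - 70 / 9 * (q : ℚ) ^ 2 +
          160 / 9 * q - 32 / 3) ∧
    (numPairs F 3 : ℚ) =
      1 / 18 * ((q : ℚ) + 1) * ((q : ℚ) - 1) ^ 3 * (q : ℚ) ^ 5 * ((q : ℚ) ^ 2 + q + 1) *
        ((q : ℚ) ^ 5 + 9 / 2 * (q : ℚ) ^ 4 + 3 / 2 * (q : ℚ) ^ 3 + 39 / 2 * (q : ℚ) ^ 2 +
          79 / 2 * q - 9) ∧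
    (numPairs F 4 : ℚ) =
      1 / 48 * ((q : ℚ) + 1) * ((q : ℚ) - 1) ^ 3 * (q : ℚ) ^ 6 * ((q : ℚ) ^ 2 + q + 1) *
        ((q : ℚ) ^ 4 + 13 * (q : ℚ) ^ 2 + 26 * q - 48) ∧
    (numPairs F 5 : ℚ) =
      1 / 24 * ((q : ℚ) + 1) * ((q : ℚ) - 1) ^ 4 * (q : ℚ) ^ 6 * ((q : ℚ) ^ 2 + q + 1) *
        ((q : ℚ) ^ 2 + 2 * q - 5) ∧
    (numPairs F 6 : ℚ) =
      1 / 720 * ((q : ℚ) - 2) * ((q : ℚ) + 1) * ((q : ℚ) - 1) ^ 4 * (q : ℚ) ^ 6 *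
        ((q : ℚ) ^ 2 + q + 1) * ((q : ℚ) ^ 2 + 3 * q - 8) := by
  obtain ⟨n0, n1, n2, n3⟩ := typeCount_values hF (by omega)
  have key : ∀ j ≤ 6, _ := fun j hj => sum_choose_mul_numPairs (F := F) (hF ▸ hq) (j := j)
    (Nat.le_succ_of_le hj)
  have e0 := key 0 (by norm_num)
  have e1 := key 1 (by norm_num)
  have e2 := key 2 (by norm_num)
  have e3 := key 3 (by norm_num)
  have e4 := key 4 (by norm_num)
  have e5 := key 5 (by norm_num)
  have e6 := key 6 (by norm_num)
  clear key
  simp only [hF, Fin.sum_univ_four, typeMoment, Matrix.cons_val, n0, n1, n2, n3, twoLineTerm,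
    Finset.Nat.antidiagonal_succ, Finset.Nat.antidiagonal_zero, Finset.sum_cons, Finset.map_cons,
    Finset.map_singleton, Finset.sum_singleton, Finset.sum_range_succ,
    Finset.sum_range_zero, cast_choose_succ,
    Nat.choose_zero_right] at e0 e1 e2 e3 e4 e5 e6
  norm_num [cast_choose_succ] at e0 e1 e2 e3 e4 e5 e6
  refine ⟨?_, ?_, ?_, ?_, ?_, ?_, ?_⟩
  -- Binomial inversion: c_k is the sum over j of (-1)^(j-k) C(j, k) times the `j`-th moment.
  · linear_combination e0 - e1 + e2 - e3 + e4 - e5 + e6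
  · linear_combination e1 - 2 * e2 + 3 * e3 - 4 * e4 + 5 * e5 - 6 * e6
  · linear_combination e2 - 3 * e3 + 6 * e4 - 10 * e5 + 15 * e6
  · linear_combination e3 - 4 * e4 + 10 * e5 - 20 * e6
  · linear_combination e4 - 5 * e5 + 15 * e6
  · linear_combination e5 - 6 * e6
  · linear_combination e6

end Formulas

/-! ### From codewords to forms: the identity of weight enumerators. -/

section Enumerators

variable {F : Type*} [Field F]

theorem wtPair_zero_left {ι : Type*} (c : ι → F) : wtPair 0 c = wt c := by
  simp [wtPair, wt]

theorem wtPair_zero_right {ι : Type*} (c : ι → F) : wtPair c 0 = wt c := by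
  simp [wtPair, wt]

variable [Finite F]

theorem ev_injOn_forms {d : ℕ} (hd : d ≤ Nat.card F) :
    Function.Injective ((ev F 2).domRestrict (forms F d)) := by
  rw [← LinearMap.ker_eq_bot, LinearMap.ker_eq_bot']
  rintro ⟨f, hf⟩ h
  have h1 : ∀ p : ℙ F (Fin 3 → F), eval p.rep f = 0 := fun p => by
    have := congrFun h p
    simpa [ev, aeval_eq_eval] using this
  apply Subtype.ext
  -- In degree 0 a form need not vanish at the origin, so constants are treated separately.
  rcases Nat.eq_zero_or_pos d with rfl | hd0
  · exact eq_zero_of_forms_zero hf (p := Projectivization.mk F (fun _ => 1)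
      (fun h => one_ne_zero (congrFun h 0))) (h1 _)
  refine IsHomogeneous.eq_zero_of_forall_eval_eq_zero_of_le_card hf (fun v => ?_) ?_
  · by_cases hv : v = 0
    · rw [hv]
      have := eval_smul_of_mem_forms hf 0 0
      rwa [zero_smul, zero_pow hd0.ne', zero_mul] at this
    · exact (mk_mem_zeros hf hv).1 (h1 _)
  · rw [← Nat.cast_card, Nat.cast_le]
    exact hd

/-- Forms of degree at most `q` correspond to codewords. -/
noncomputable def formsEquivProjRM {d : ℕ} (hd : d ≤ Nat.card F) : forms F d ≃ projRM F 2 d :=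
  Equiv.ofBijective (fun f => ⟨ev F 2 f.1, Submodule.mem_map_of_mem f.2⟩)
    ⟨fun f g h => ev_injOn_forms hd (congrArg Subtype.val h), fun ⟨c, hc⟩ => by
      obtain ⟨f, hf, rfl⟩ := hc
      exact ⟨⟨f, hf⟩, rfl⟩⟩

theorem finsum_forms {M : Type*} [AddCommMonoid M] (d : ℕ) (φ : MvPolynomial (Fin 3) F → M) :
    ∑ᶠ f : forms F d, φ f = ∑ f ∈ formsFinset F d, φ f := by
  rw [← finsum_mem_coe_finset, formsFinset, Set.Finite.coe_toFinset]
  exact finsum_set_coe_eq_finsum_mem (forms F d : Set (MvPolynomial (Fin 3) F))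

theorem weightEnum_projRM {d : ℕ} (hd : d ≤ Nat.card F) :
    weightEnum (projRM F 2 d) = ∑ f ∈ formsFinset F d,
      wtMonomial (Nat.card (ℙ F (Fin 3 → F))) (wt (ev F 2 f)) := by
  rw [← finsum_forms, weightEnum]
  exact (finsum_comp_equiv (formsEquivProjRM hd)
    (f := fun c => wtMonomial (Nat.card (ℙ F (Fin 3 → F))) (wt (c : ℙ F (Fin 3 → F) → F)))).symm

theorem weightEnum₂_projRM {d e : ℕ} (hd : d ≤ Nat.card F) (he : e ≤ Nat.card F) :
    weightEnum₂ (projRM F 2 d) (projRM F 2 e) = ∑ f ∈ formsFinset F d, ∑ g ∈ formsFinset F e,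
      wtMonomial (Nat.card (ℙ F (Fin 3 → F))) (wtPair (ev F 2 f) (ev F 2 g)) := by
  rw [weightEnum₂, ← finsum_comp_equiv ((formsEquivProjRM hd).prodCongr (formsEquivProjRM he)),
    finsum_curry _ (Set.toFinite _)]
  simp only [← finsum_forms]
  rfl

theorem wtPair_ev (f g : MvPolynomial (Fin 3) F) :
    wtPair (ev F 2 f) (ev F 2 g) =
      Nat.card (ℙ F (Fin 3 → F)) - (zeros f ∩ zeros g).ncard := by
  rw [← Set.ncard_compl, wtPair]
  rfl

theorem wtMonomial_wtPair_ev (f g : MvPolynomial (Fin 3) F) :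
    wtMonomial (Nat.card (ℙ F (Fin 3 → F))) (wtPair (ev F 2 f) (ev F 2 g)) =
      X 0 ^ (zeros f ∩ zeros g).ncard *
        X 1 ^ (Nat.card (ℙ F (Fin 3 → F)) - (zeros f ∩ zeros g).ncard) := by
  have h : (zeros f ∩ zeros g).ncard ≤ Nat.card (ℙ F (Fin 3 → F)) := Set.ncard_le_card _
  rw [wtMonomial, wtPair_ev, Nat.sub_sub_self h]

open scoped Classical in
theorem weightEnumCom_eq_sum : weightEnumCom F = ∑ f ∈ (formsFinset F 2).erase 0,
    ∑ g ∈ ((formsFinset F 3).erase 0).filter fun g => ShareComponent (n := 2) f g,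
      wtMonomial (Nat.card (ℙ F (Fin 3 → F))) (wtPair (ev F 2 f) (ev F 2 g)) := by
  have hs : {x ∈ conicCubicPairs F | ShareComponent (n := 2) x.1 x.2} =
      (((((formsFinset F 2).erase 0) ×ˢ ((formsFinset F 3).erase 0)).filter
        fun x => ShareComponent (n := 2) x.1 x.2 : Finset _) : Set _) := by
    ext ⟨f, g⟩
    simp only [conicCubicPairs, Set.mem_ofPred_eq, Finset.coe_filter, Finset.mem_product,
      Finset.mem_erase, mem_formsFinset, mem_homogeneousSubmodule]
    tauto
  rw [weightEnumCom, hs, finsum_mem_coe_finset, Finset.sum_filter, Finset.sum_product]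
  simp only [Finset.sum_filter]

open scoped Classical in
theorem sum_partners_eq_sum_numPairs {n : ℕ} :
    ∑ f ∈ (formsFinset F 2).erase 0, ∑ g ∈ partners f,
      (X 0 ^ (zeros f ∩ zeros g).ncard * X 1 ^ (n - (zeros f ∩ zeros g).ncard) :
        MvPolynomial (Fin 2) ℤ) =
      ∑ k ∈ Finset.range 7, C (numPairs F k : ℤ) * (X 0 ^ k * X 1 ^ (n - k)) := by
  classical
  simp only [numPairs_eq_sum, Nat.cast_sum, map_sum, Finset.sum_mul]
  rw [Finset.sum_comm]
  refine Finset.sum_congr rfl fun f hf => ?_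
  rw [Finset.mem_erase, mem_formsFinset] at hf
  rw [← Finset.sum_fiberwise_of_maps_to
    (t := Finset.range 7) (g := fun g => (zeros f ∩ zeros g).ncard)]
  · refine Finset.sum_congr rfl fun k _ => ?_
    rw [Finset.sum_congr rfl (g := fun _ => X 0 ^ k * X 1 ^ (n - k)), Finset.sum_const,
      nsmul_eq_mul]
    · simp
    · intro g hg
      rw [(Finset.mem_filter.1 hg).2]
  · intro g hg
    rw [Finset.mem_range]
    have := ncard_zeros_inter_le_six hf.2 hf.1 hg
    omega

theorem weightEnum₂_conic_cubic {q : ℕ} (hF : Nat.card F = q) (hq : 2 < q) :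
    weightEnum₂ (projRM F 2 2) (projRM F 2 3) =
      weightEnum (projRM F 2 2) + weightEnum (projRM F 2 3) -
        (X 0 : MvPolynomial (Fin 2) ℤ) ^ (q ^ 2 + q + 1) + weightEnumCom F +
        ∑ k ∈ Finset.range 7, C (numPairs F k : ℤ) *
          (X 0 ^ k * X 1 ^ (q ^ 2 + q + 1 - k)) := by
  classical
  have hn : Nat.card (ℙ F (Fin 3 → F)) = q ^ 2 + q + 1 := by rw [card_points, hF]
  rw [weightEnum₂_projRM (by omega) (by omega), weightEnum_projRM (by omega),
    weightEnum_projRM (by omega), weightEnumCom_eq_sum, ← sum_partners_eq_sum_numPairs, ← hn]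
  simp only [← wtMonomial_wtPair_ev]
  set φ : MvPolynomial (Fin 3) F → MvPolynomial (Fin 3) F → MvPolynomial (Fin 2) ℤ :=
    fun f g => wtMonomial (Nat.card (ℙ F (Fin 3 → F))) (wtPair (ev F 2 f) (ev F 2 g)) with hφ
  have h0 : ∀ d, (0 : MvPolynomial (Fin 3) F) ∈ formsFinset F d :=
    fun d => mem_formsFinset.2 (zero_mem _)
  have e1 : ∀ g, wtMonomial (Nat.card (ℙ F (Fin 3 → F))) (wt (ev F 2 g)) = φ 0 g := fun g => by
    rw [hφ]
    simp only [map_zero, wtPair_zero_left]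
  have e2 : ∀ f, wtMonomial (Nat.card (ℙ F (Fin 3 → F))) (wt (ev F 2 f)) = φ f 0 := fun f => by
    rw [hφ]
    simp only [map_zero, wtPair_zero_right]
  have e3 : (X 0 : MvPolynomial (Fin 2) ℤ) ^ Nat.card (ℙ F (Fin 3 → F)) = φ 0 0 := by
    rw [← e1]
    simp [wtMonomial, wt]
  -- For `f ≠ 0` the cubics split into zero, nonzero ones sharing a component, and partners. The row
  -- `f = 0` is left whole; the pair (0, 0) lies in both single enumerators, which explains the
  -- subtracted power of X.
  have e4 : ∀ f ∈ (formsFinset F 2).erase 0, ∑ g ∈ formsFinset F 3, φ f g = φ f 0 +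
      (∑ g ∈ ((formsFinset F 3).erase 0).filter (fun g => ShareComponent (n := 2) f g), φ f g +
        ∑ g ∈ partners f, φ f g) := by
    intro f hf
    rw [Finset.mem_erase, mem_formsFinset] at hf
    rw [← Finset.add_sum_erase _ _ (h0 3), ← Finset.sum_filter_add_sum_filter_not
      ((formsFinset F 3).erase 0) (fun g => ShareComponent (n := 2) f g)]
    congr 2
    refine Finset.sum_congr ?_ fun _ _ => rfl
    ext g
    rw [Finset.mem_filter, Finset.mem_erase, partners, Finset.mem_filter]
    refine ⟨fun h => ⟨h.1.2, h.2⟩, fun h => ⟨⟨?_, h.1⟩, h.2⟩⟩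
    rintro rfl
    exact h.2 (shareComponent_zero (not_isUnit_of_mem_forms two_ne_zero hf.2) hf.1)
  rw [Finset.sum_congr (s₁ := formsFinset F 3) rfl fun g _ => e1 g,
    Finset.sum_congr (s₁ := formsFinset F 2) rfl fun f _ => e2 f, e3]
  change ∑ f ∈ formsFinset F 2, ∑ g ∈ formsFinset F 3, φ f g = _ + _ - _ +
    ∑ f ∈ (formsFinset F 2).erase 0, ∑ g ∈ ((formsFinset F 3).erase 0).filter
      (fun g => ShareComponent (n := 2) f g), φ f g +
    ∑ f ∈ (formsFinset F 2).erase 0, ∑ g ∈ partners f, φ f g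
  rw [← Finset.add_sum_erase (formsFinset F 2) (fun f => ∑ g ∈ formsFinset F 3, φ f g) (h0 2),
    Finset.sum_congr rfl e4,
    ← Finset.add_sum_erase (formsFinset F 2) (fun f => φ f 0) (h0 2), Finset.sum_add_distrib,
    Finset.sum_add_distrib]
  ring

end Enumerators

end ConicCubic

theorem mainTheorem4 {F : Type*} [Field F] [Finite F] (q : ℕ) (hF : Nat.card F = q) (hq : 2 < q) :
    (ConicCubic.weightEnum₂ (ConicCubic.projRM F 2 2) (ConicCubic.projRM F 2 3) =
      ConicCubic.weightEnum (ConicCubic.projRM F 2 2) +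
        ConicCubic.weightEnum (ConicCubic.projRM F 2 3) -
        (MvPolynomial.X 0 : MvPolynomial (Fin 2) ℤ) ^ (q ^ 2 + q + 1) +
        ConicCubic.weightEnumCom F +
        ∑ k ∈ Finset.range 7, MvPolynomial.C (ConicCubic.numPairs F k : ℤ) *
          (MvPolynomial.X 0 ^ k * MvPolynomial.X 1 ^ (q ^ 2 + q + 1 - k))) ∧
    (ConicCubic.numPairs F 0 : ℚ) =
      53 / 144 * ((q : ℚ) - 1) ^ 3 * (q : ℚ) ^ 6 * ((q : ℚ) ^ 2 + q + 1) *
        ((q : ℚ) ^ 5 + (q : ℚ) ^ 4 + 9 / 53 * (q : ℚ) ^ 3 + 27 / 53 * (q : ℚ) ^ 2 +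
          58 / 53 * q - 32 / 53) ∧
    (ConicCubic.numPairs F 1 : ℚ) =
      11 / 30 * (q : ℚ) ^ 4 * ((q : ℚ) - 1) ^ 2 * ((q : ℚ) ^ 2 + q + 1) * ((q : ℚ) + 1) *
        ((q : ℚ) ^ 7 + 1 / 44 * (q : ℚ) ^ 6 + 5 / 11 * (q : ℚ) ^ 5 + 20 / 11 * (q : ℚ) ^ 4 -
          31 / 11 * (q : ℚ) ^ 3 + 159 / 44 * (q : ℚ) ^ 2 + 15 / 11 * q - 30 / 11) ∧
    (ConicCubic.numPairs F 2 : ℚ) =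
      3 / 16 * ((q : ℚ) - 1) ^ 2 * ((q : ℚ) + 1) ^ 2 * (q : ℚ) ^ 5 * ((q : ℚ) ^ 2 + q + 1) *
        ((q : ℚ) ^ 5 - 2 / 9 * (q : ℚ) ^ 4 + 35 / 9 * (q : ℚ) ^ 3 - 70 / 9 * (q : ℚ) ^ 2 +
          160 / 9 * q - 32 / 3) ∧
    (ConicCubic.numPairs F 3 : ℚ) =
      1 / 18 * ((q : ℚ) + 1) * ((q : ℚ) - 1) ^ 3 * (q : ℚ) ^ 5 * ((q : ℚ) ^ 2 + q + 1) *
        ((q : ℚ) ^ 5 + 9 / 2 * (q : ℚ) ^ 4 + 3 / 2 * (q : ℚ) ^ 3 + 39 / 2 * (q : ℚ) ^ 2 +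
          79 / 2 * q - 9) ∧
    (ConicCubic.numPairs F 4 : ℚ) =
      1 / 48 * ((q : ℚ) + 1) * ((q : ℚ) - 1) ^ 3 * (q : ℚ) ^ 6 * ((q : ℚ) ^ 2 + q + 1) *
        ((q : ℚ) ^ 4 + 13 * (q : ℚ) ^ 2 + 26 * q - 48) ∧
    (ConicCubic.numPairs F 5 : ℚ) =
      1 / 24 * ((q : ℚ) + 1) * ((q : ℚ) - 1) ^ 4 * (q : ℚ) ^ 6 * ((q : ℚ) ^ 2 + q + 1) *
        ((q : ℚ) ^ 2 + 2 * q - 5) ∧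
    (ConicCubic.numPairs F 6 : ℚ) =
      1 / 720 * ((q : ℚ) - 2) * ((q : ℚ) + 1) * ((q : ℚ) - 1) ^ 4 * (q : ℚ) ^ 6 *
        ((q : ℚ) ^ 2 + q + 1) * ((q : ℚ) ^ 2 + 3 * q - 8) := by
  exact ⟨ConicCubic.weightEnum₂_conic_cubic hF hq, ConicCubic.numPairs_values hF hq⟩
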